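/- Let $n\ge 3$ and read all colours $i$ modulo $n$. Let $\hat{\mathcal S}(n,n)$ be the diagrammatic $\mathbb Q$-linear 2-category of Mackaay and Thiel that categorifies the affine $q$-Schur algebra $\hat{\mathbf S}(n,n)$: the quotient of the Khovanov--Lauda calculus $\mathcal U(\hat{\mathfrak{gl}}_n)$ by all diagrams with a region label outside $\Lambda(n,n)=\{\lambda\in\mathbb Z_{\ge0}^n:\sum_i\lambda_i=n\}$, extended by an upward and a downward $\delta$-strand, with both adjacent regions labelled $(1^n)=(1,\dots,1)$, and by the $\delta$-splitters and their relations. Degree-zero bubbles are normalised so that, in a region labelled $\lambda$, the clockwise $i$-bubble of degree $0$ equals $(-1)^{\lambda_{i+1}}$ and the counterclockwise one equals $(-1)^{\lambda_{i+1}-1}$. For a colour $i$ and $s\in\mathbb N$ write $\circlearrowright_i^{s}$ and $\circlearrowleft_i^{s}$ for the clockwise and the counterclockwise $i$-bubble with $s$ dots in a region labelled $(1^n)$; they are elements of the commutative ring of 2-endomorphisms (of arbitrary degree) of $\mathbf 1_{(1^n)}$. Write $\uparrow_\delta$ for the upward $\delta$-strand, i.e. the identity 2-morphism of $\mathcal E_{+\delta}\mathbf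 1_{(1^n)}$, and for a closed diagram $f$ in a region labelled $(1^n)$ let $f\uparrow_\delta$ and $\uparrow_\delta f$ be the 2-endomorphisms of $\mathcal E_{+\delta}\mathbf 1_{(1^n)}$ obtained by placing $f$ to the left, respectively to the right, of the $\delta$-strand. For a colour $i$ put $$z_{i+1}:=-\sum_{c\neq i}\circlearrowleft_c^{0},\qquad y_i:=\sum_{c\ne i+1}\circlearrowright_c^{0},$$ the sums being over the $n-1$ colours $c$ modulo $n$ different from $i$, respectively from $i+1$. Then for every colour $i$ and every $s\in\mathbb N$ (with the convention $f^0=1$) $$\sum_{j=0}^{s}\binom sj\;\circlearrowright_i^{s-j}z_{i+1}^{\,j}\;\uparrow_\delta\;=\;\uparrow_\delta\;\circlearrowleft_{i+1}^{s}$$ and $$\uparrow_\delta\;\sum_{j=0}^{s}\binom sj\;\circlearrowleft_{i+1}^{s-j}y_i^{\,j}\;=\;\circlearrowright_i^{s}\;\uparrow_\delta .$$ -/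

import Mathlib

open CategoryTheory

noncomputable section

namespace AffineSchur

/-! ### Weights, strands and words -/

/-- The strands of the calculus: `up i` and `down i` are the coloured strands (identity
2-morphisms of `E_{+i}` and `E_{-i}`), with colours modulo `n`; `dup` and `ddown` are the
upward and downward delta-strands (`E_{+δ}` and `E_{-δ}`). -/
inductive Strand (n : ℕ) : Type
  | up (i : ZMod n) : Strand n
  | down (i : ZMod n) : Strand n
  | dup : Strand n
  | ddown : Strand n

open Strand

/-- `gl_n`-weights; the coordinates are indexed by residues modulo `n`. -/
abbrev Weight (n : ℕ) : Type := ZMod n → ℤ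

/-- The simple root `α_i = ε_i - ε_{i+1}`. -/
def root {n : ℕ} (i : ZMod n) : Weight n := Pi.single i 1 - Pi.single (i + 1) 1

/-- The `sl_n`-coordinate `λ_i - λ_{i+1}`. -/
def bar {n : ℕ} (μ : Weight n) (i : ZMod n) : ℤ := μ i - μ (i + 1)

/-- The weight `(1^n)`. -/
def ones (n : ℕ) : Weight n := fun _ => 1

/-- Membership in `Λ(n,n)`: nonnegative entries with sum `n`. -/
def IsSchurWeight {n : ℕ} (μ : Weight n) : Prop :=
  (∀ i, 0 ≤ μ i) ∧ ∑ k ∈ Finset.range n, μ (k : ZMod n) = n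

/-- The label of the region to the left of a strand, given the label of the region to its
right. -/
def Strand.act {n : ℕ} : Strand n → Weight n → Weight n
  | up i, μ => μ + root i
  | down i, μ => μ - root i
  | dup, μ => μ
  | ddown, μ => μ

/-- A 1-morphism is a word of strands (read from left to right) together with the label of the
rightmost region. -/
abbrev Word (n : ℕ) : Type := List (Strand n)

/-- The label of the leftmost region of a word with rightmost label `μ`. -/
def leftWeight {n : ℕ} : Word n → Weight n → Weight n
  | [], μ => μ
  | s :: w, μ => s.act (leftWeight w μ)

/-- All regions of the word carry labels in `Λ(n,n)`, and every delta-strand has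
label `(1^n)` on both sides. -/
def Admissible {n : ℕ} : Word n → Weight n → Prop
  | [], μ => IsSchurWeight μ
  | s :: w, μ => Admissible w μ ∧ IsSchurWeight (s.act (leftWeight w μ)) ∧
      (s = dup ∨ s = ddown → leftWeight w μ = ones n)

/-- Upward strands with the given colours, from left to right. -/
def ups {n : ℕ} (L : List (ZMod n)) : Word n := L.map up

/-- Downward strands with the given colours, from left to right. -/
def downs {n : ℕ} (L : List (ZMod n)) : Word n := L.map down

/-- The colours `i, i-1, ..., i-k+1` (modulo `n`). -/
def descending {n : ℕ} (i : ZMod n) : ℕ → List (ZMod n)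
  | 0 => []
  | k + 1 => i :: descending (i - 1) k

/-- The colours `i, i-1, ..., 1, n, ..., i+2, i+1`, in this order: every colour once. -/
def colors {n : ℕ} (i : ZMod n) : List (ZMod n) := descending i n

/-! ### Generating 2-morphisms and diagrams

Diagrams are read from bottom to top, so `f ≫ g` is `g` stacked on top of `f`. -/

/-- The non-identity generating 2-morphisms, as maps from the bottom word to the top word.
`capR`, `cupR` (`capL`, `cupL`) are the caps and cups whose arc is oriented from left to right
(from right to left).  With `colors i = (i, i-1, ..., i+1)`, the generator `splitUp i` is the
splitter `E_δ → E_i E_{i-1} ⋯ E_{i+1}` and `splitDown i` is the splitter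
`E_{-δ} → E_{-(i+1)} E_{-(i+2)} ⋯ E_{-i}`; similarly for `mergeUp`, `mergeDown`. -/
inductive Gen (n : ℕ) : Word n → Word n → Type
  | dotUp (i : ZMod n) : Gen n [up i] [up i]
  | dotDown (i : ZMod n) : Gen n [down i] [down i]
  | crossUp (i j : ZMod n) : Gen n [up i, up j] [up j, up i]
  | crossDown (i j : ZMod n) : Gen n [down i, down j] [down j, down i]
  | capR (i : ZMod n) : Gen n [up i, down i] []
  | capL (i : ZMod n) : Gen n [down i, up i] []
  | cupR (i : ZMod n) : Gen n [] [down i, up i]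
  | cupL (i : ZMod n) : Gen n [] [up i, down i]
  | deltaCapR : Gen n [dup, ddown] []
  | deltaCapL : Gen n [ddown, dup] []
  | deltaCupR : Gen n [] [ddown, dup]
  | deltaCupL : Gen n [] [dup, ddown]
  | splitUp (i : ZMod n) : Gen n [dup] (ups (colors i))
  | splitDown (i : ZMod n) : Gen n [ddown] (downs (colors i).reverse)
  | mergeUp (i : ZMod n) : Gen n (ups (colors i)) [dup]
  | mergeDown (i : ZMod n) : Gen n (downs (colors i).reverse) [ddown]

open Gen

/-- A horizontal slice of a diagram: one generator, with identity strands `left` and `right`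
of it. -/
structure Layer (n : ℕ) (x y : Word n) : Type where
  left : Word n
  right : Word n
  bottom : Word n
  top : Word n
  gen : Gen n bottom top
  source_eq : x = left ++ (bottom ++ right)
  target_eq : y = left ++ (top ++ right)

instance layerQuiver (n : ℕ) : Quiver (Word n) where
  Hom x y := Layer n x y

/-- Words and formal `ℚ`-linear combinations of diagrams (vertical stacks of layers). -/
abbrev Diag (n : ℕ) : Type := Free ℚ (Paths (Word n))

/-- A word as an object of the category of formal diagrams. -/
abbrev ob {n : ℕ} (w : Word n) : Diag n := w

/-- The diagram with the single generator `g`, and identity strands `a` on its left and `b` on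
its right. -/
def lay {n : ℕ} (a : Word n) {u v : Word n} (g : Gen n u v) (b : Word n) {x y : Word n}
    (hx : x = a ++ (u ++ b)) (hy : y = a ++ (v ++ b)) : ob x ⟶ ob y :=
  (Free.embedding ℚ (Paths (Word n))).map
    ((Paths.of (Word n)).map (⟨a, b, u, v, g, hx, hy⟩ : Layer n x y))

/-- `lay` with literal source and target. -/
abbrev sl {n : ℕ} (a : Word n) {u v : Word n} (g : Gen n u v) (b : Word n) :
    ob (a ++ (u ++ b)) ⟶ ob (a ++ (v ++ b)) :=
  lay a g b rfl rfl

/-- The difference of two linear combinations of diagrams. -/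
abbrev diff {n : ℕ} {x y : Word n} (f g : ob x ⟶ ob y) : ob x ⟶ ob y := f - g

/-- Placing identity strands `a` to the left and `b` to the right of a diagram. -/
def whiskerPre (n : ℕ) (a b : Word n) : Word n ⥤q Diag n where
  obj x := ob (a ++ (x ++ b))
  map {_ _} l := lay (a ++ l.left) l.gen (l.right ++ b)
    (by simp [l.source_eq]) (by simp [l.target_eq])

/-- Placing identity strands `a` to the left and `b` to the right, on linear combinations of
diagrams. -/
def whisker {n : ℕ} (a b : Word n) : Diag n ⥤ Diag n :=
  Free.lift ℚ (Paths.lift (whiskerPre n a b))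

/-- `k` dots on an upward `i`-strand. -/
def dots {n : ℕ} (a : Word n) (i : ZMod n) (k : ℕ) (b : Word n) :
    ob (a ++ ([up i] ++ b)) ⟶ ob (a ++ ([up i] ++ b)) :=
  (show End (ob (a ++ ([up i] ++ b))) from sl a (dotUp i) b) ^ k

/-! ### Bubbles -/

/-- The clockwise `i`-bubble with `k` dots. -/
def cwBubble {n : ℕ} (i : ZMod n) (k : ℕ) : End (ob ([] : Word n)) :=
  sl [] (cupL i) [] ≫ dots [] i k [down i] ≫ sl [] (capR i) []

/-- The counterclockwise `i`-bubble with `k` dots. -/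
def ccwBubble {n : ℕ} (i : ZMod n) (k : ℕ) : End (ob ([] : Word n)) :=
  sl [] (cupR i) [] ≫ dots [down i] i k [] ≫ sl [] (capL i) []

/-- The clockwise `i`-bubble of degree `2α` in a region labelled `μ`, i.e. with
`(μ_i - μ_{i+1}) - 1 + α` dots.  If this number is negative the bubble is fake, and it is the
solution of the infinite Grassmannian relation. -/
def cw {n : ℕ} (μ : Weight n) (i : ZMod n) (α : ℕ) : End (ob ([] : Word n)) :=
  if 0 ≤ bar μ i - 1 + α then cwBubble i (bar μ i - 1 + α).toNat
  else if α = 0 then ((-1 : ℚ) ^ (μ (i + 1))) • 𝟙 (ob ([] : Word n))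
  else ((-1 : ℚ) ^ (μ (i + 1))) •
    ∑ a : Fin α, (cw μ i a ≫ ccwBubble i (-bar μ i - 1 + (α - (a : ℕ) : ℤ)).toNat :
      ob ([] : Word n) ⟶ ob ([] : Word n))
termination_by α
decreasing_by exact a.2

/-- The counterclockwise `i`-bubble of degree `2α` in a region labelled `μ`, i.e. with
`-(μ_i - μ_{i+1}) - 1 + α` dots.  If this number is negative the bubble is fake, and it is the
solution of the infinite Grassmannian relation. -/
def ccw {n : ℕ} (μ : Weight n) (i : ZMod n) (α : ℕ) : End (ob ([] : Word n)) :=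
  if 0 ≤ -bar μ i - 1 + α then ccwBubble i (-bar μ i - 1 + α).toNat
  else if α = 0 then ((-1 : ℚ) ^ (μ (i + 1) - 1)) • 𝟙 (ob ([] : Word n))
  else ((-1 : ℚ) ^ (μ (i + 1) - 1)) •
    ∑ a : Fin α, (ccw μ i a ≫ cwBubble i (bar μ i - 1 + (α - (a : ℕ) : ℤ)).toNat :
      ob ([] : Word n) ⟶ ob ([] : Word n))
termination_by α
decreasing_by exact a.2

/-! ### Composite diagrams used in the relations -/

/-- The sideways crossing `E_i E_{-j} → E_{-j} E_i`. -/
def crossRight {n : ℕ} (i j : ZMod n) : ob [up i, down j] ⟶ ob [down j, up i] :=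
  sl [] (cupR j) [up i, down j] ≫ sl [down j] (crossUp j i) [down j] ≫
    sl [down j, up i] (capR j) []

/-- The sideways crossing `E_{-j} E_i → E_i E_{-j}`. -/
def crossLeft {n : ℕ} (i j : ZMod n) : ob [down j, up i] ⟶ ob [up i, down j] :=
  sl [down j, up i] (cupL j) [] ≫ sl [down j] (crossUp i j) [down j] ≫
    sl [] (capL j) [up i, down j]

/-- An upward `i`-strand crosses the upward strands with colours `M`, from left to right. -/
def passRight {n : ℕ} (i : ZMod n) : (M : List (ZMod n)) → (a b : Word n) → {x y : Word n} →
    x = a ++ (up i :: (ups M ++ b)) → y = a ++ (ups M ++ (up i :: b)) → (ob x ⟶ ob y)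
  | [], _, _, _, _, hx, hy => eqToHom (by rw [hx, hy]; rfl)
  | j :: M, a, b, _, _, hx, hy =>
      lay a (crossUp i j) (ups M ++ b) (y := a ++ (up j :: up i :: (ups M ++ b))) hx rfl ≫
        passRight i M (a ++ [up j]) b (by simp) (by simp [hy, ups])

/-- An upward `i`-strand crosses the upward strands with colours `M`, from right to left. -/
def passLeft {n : ℕ} (i : ZMod n) : (M : List (ZMod n)) → (a b : Word n) → {x y : Word n} →
    x = a ++ (ups M ++ (up i :: b)) → y = a ++ (up i :: (ups M ++ b)) → (ob x ⟶ ob y)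
  | [], _, _, _, _, hx, hy => eqToHom (by rw [hx, hy]; rfl)
  | j :: M, a, b, _, _, hx, hy =>
      passLeft i M (a ++ [up j]) b (y := a ++ (up j :: up i :: (ups M ++ b)))
          (by simp [hx, ups]) (by simp) ≫
        lay a (crossUp j i) (ups M ++ b) rfl hy

/-- The block of upward strands with colours `L` crosses the block with colours `M`. -/
def blockCross {n : ℕ} : (L M : List (ZMod n)) → (a b : Word n) → {x y : Word n} →
    x = a ++ (ups L ++ (ups M ++ b)) → y = a ++ (ups M ++ (ups L ++ b)) → (ob x ⟶ ob y)
  | [], _, _, _, _, _, hx, hy => eqToHom (by rw [hx, hy]; rfl)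
  | i :: L, M, a, b, _, _, hx, hy =>
      blockCross L M (a ++ [up i]) b (y := a ++ (up i :: (ups M ++ (ups L ++ b))))
          (by simp [hx, ups]) (by simp) ≫
        passRight i M a (ups L ++ b) rfl (by simp [hy, ups])

/-- Nested cups oriented from left to right. -/
def cupsR {n : ℕ} : (L : List (ZMod n)) → (a b : Word n) → {x y : Word n} →
    x = a ++ b → y = a ++ (downs L.reverse ++ (ups L ++ b)) → (ob x ⟶ ob y)
  | [], _, _, _, _, hx, hy => eqToHom (by rw [hx, hy]; rfl)
  | i :: L, a, b, _, _, hx, hy =>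
      cupsR L a b (y := a ++ (downs L.reverse ++ (ups L ++ b))) hx rfl ≫
        lay (a ++ downs L.reverse) (cupR i) (ups L ++ b) (by simp) (by simp [hy, ups, downs])

/-- Nested cups oriented from right to left. -/
def cupsL {n : ℕ} : (L : List (ZMod n)) → (a b : Word n) → {x y : Word n} →
    x = a ++ b → y = a ++ (ups L ++ (downs L.reverse ++ b)) → (ob x ⟶ ob y)
  | [], _, _, _, _, hx, hy => eqToHom (by rw [hx, hy]; rfl)
  | i :: L, a, b, _, _, hx, hy =>
      lay a (cupL i) b (y := a ++ (up i :: down i :: b)) hx rfl ≫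
        cupsL L (a ++ [up i]) (down i :: b) (by simp) (by simp [hy, ups, downs])

/-- Nested caps oriented from left to right. -/
def capsR {n : ℕ} : (L : List (ZMod n)) → (a b : Word n) → {x y : Word n} →
    x = a ++ (ups L ++ (downs L.reverse ++ b)) → y = a ++ b → (ob x ⟶ ob y)
  | [], _, _, _, _, hx, hy => eqToHom (by rw [hx, hy]; rfl)
  | i :: L, a, b, _, _, hx, hy =>
      capsR L (a ++ [up i]) (down i :: b) (y := a ++ (up i :: down i :: b))
          (by simp [hx, ups, downs]) (by simp) ≫
        lay a (capR i) b rfl hy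

/-- Nested caps oriented from right to left. -/
def capsL {n : ℕ} : (L : List (ZMod n)) → (a b : Word n) → {x y : Word n} →
    x = a ++ (downs L.reverse ++ (ups L ++ b)) → y = a ++ b → (ob x ⟶ ob y)
  | [], _, _, _, _, hx, hy => eqToHom (by rw [hx, hy]; rfl)
  | i :: L, a, b, _, _, hx, hy =>
      lay (a ++ downs L.reverse) (capL i) (ups L ++ b)
          (y := a ++ (downs L.reverse ++ (ups L ++ b)))
          (by simp [hx, ups, downs]) (by simp) ≫
        capsL L a b rfl hy

/-! ### The relations -/

/-- The defining relations `f = g` between diagrams with rightmost label `μ`. -/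
inductive Relator {n : ℕ} : Weight n → {x y : Word n} → (ob x ⟶ ob y) → (ob x ⟶ ob y) → Prop
  -- Diagrams with a forbidden region vanish.
  | forbidden (μ : Weight n) (w : Word n) (h : ¬ Admissible w μ) : Relator μ (𝟙 (ob w)) 0
  -- Interchange law: distant generators commute.
  | interchange (μ : Weight n) {u v u' v' : Word n} (g : Gen n u v) (m : Word n)
      (g' : Gen n u' v') :
      Relator μ (x := u ++ (m ++ u')) (y := v ++ (m ++ v'))
        (lay [] g (m ++ u') (y := v ++ (m ++ u')) rfl rfl ≫
          lay (v ++ m) g' [] (by simp) (by simp))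
        (lay (u ++ m) g' [] (y := u ++ (m ++ v')) (by simp) (by simp) ≫
          lay [] g (m ++ v') rfl rfl)
  -- Biadjointness of coloured strands.
  | zigzagUp₁ (μ : Weight n) (i : ZMod n) : Relator μ (x := [up i]) (y := [up i])
      (sl [] (cupL i) [up i] ≫ sl [up i] (capL i) []) (𝟙 _)
  | zigzagUp₂ (μ : Weight n) (i : ZMod n) : Relator μ (x := [up i]) (y := [up i])
      (sl [up i] (cupR i) [] ≫ sl [] (capR i) [up i]) (𝟙 _)
  | zigzagDown₁ (μ : Weight n) (i : ZMod n) : Relator μ (x := [down i]) (y := [down i])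
      (sl [] (cupR i) [down i] ≫ sl [down i] (capR i) []) (𝟙 _)
  | zigzagDown₂ (μ : Weight n) (i : ZMod n) : Relator μ (x := [down i]) (y := [down i])
      (sl [down i] (cupL i) [] ≫ sl [] (capL i) [down i]) (𝟙 _)
  -- Cyclicity of dots and crossings.
  | dotCyclic₁ (μ : Weight n) (i : ZMod n) : Relator μ (x := [down i]) (y := [down i])
      (sl [] (dotDown i) [])
      (sl [] (cupR i) [down i] ≫ sl [down i] (dotUp i) [down i] ≫ sl [down i] (capR i) [])
  | dotCyclic₂ (μ : Weight n) (i : ZMod n) : Relator μ (x := [down i]) (y := [down i])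
      (sl [] (dotDown i) [])
      (sl [down i] (cupL i) [] ≫ sl [down i] (dotUp i) [down i] ≫ sl [] (capL i) [down i])
  | crossCyclic₁ (μ : Weight n) (i j : ZMod n) :
      Relator μ (x := [down i, down j]) (y := [down j, down i])
      (sl [] (crossDown i j) [])
      (sl [] (cupR j) [down i, down j] ≫ sl [down j] (cupR i) [up j, down i, down j] ≫
        sl [down j, down i] (crossUp i j) [down i, down j] ≫
        sl [down j, down i, up j] (capR i) [down j] ≫ sl [down j, down i] (capR j) [])
  | crossCyclic₂ (μ : Weight n) (i j : ZMod n) :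
      Relator μ (x := [down i, down j]) (y := [down j, down i])
      (sl [] (crossDown i j) [])
      (sl [down i, down j] (cupL i) [] ≫ sl [down i, down j, up i] (cupL j) [down i] ≫
        sl [down i, down j] (crossUp i j) [down j, down i] ≫
        sl [down i] (capL j) [up i, down j, down i] ≫ sl [] (capL i) [down j, down i])
  -- Reidemeister 2 for strands of the same orientation.
  | crossSqSame (μ : Weight n) (i : ZMod n) : Relator μ (x := [up i, up i]) (y := [up i, up i])
      (sl [] (crossUp i i) [] ≫ sl [] (crossUp i i) []) 0
  | crossSqFar (μ : Weight n) (i j : ZMod n) (hij : i ≠ j) (h₁ : j ≠ i + 1) (h₂ : i ≠ j + 1) :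
      Relator μ (x := [up i, up j]) (y := [up i, up j])
      (sl [] (crossUp i j) [] ≫ sl [] (crossUp j i) []) (𝟙 _)
  | crossSqSucc (μ : Weight n) (i : ZMod n) :
      Relator μ (x := [up i, up (i + 1)]) (y := [up i, up (i + 1)])
      (sl [] (crossUp i (i + 1)) [] ≫ sl [] (crossUp (i + 1) i) [])
      (diff (sl [up i] (dotUp (i + 1)) []) (sl [] (dotUp i) [up (i + 1)]))
  | crossSqPred (μ : Weight n) (i : ZMod n) :
      Relator μ (x := [up (i + 1), up i]) (y := [up (i + 1), up i])
      (sl [] (crossUp (i + 1) i) [] ≫ sl [] (crossUp i (i + 1)) [])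
      (diff (sl [] (dotUp (i + 1)) [up i]) (sl [up (i + 1)] (dotUp i) []))
  -- Dots and crossings.
  | dotSlide₁ (μ : Weight n) (i j : ZMod n) (hij : i ≠ j) :
      Relator μ (x := [up i, up j]) (y := [up j, up i])
      (sl [] (dotUp i) [up j] ≫ sl [] (crossUp i j) [])
      (sl [] (crossUp i j) [] ≫ sl [up j] (dotUp i) [])
  | dotSlide₂ (μ : Weight n) (i j : ZMod n) (hij : i ≠ j) :
      Relator μ (x := [up i, up j]) (y := [up j, up i])
      (sl [up i] (dotUp j) [] ≫ sl [] (crossUp i j) [])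
      (sl [] (crossUp i j) [] ≫ sl [] (dotUp j) [up i])
  | nilHecke₁ (μ : Weight n) (i : ZMod n) : Relator μ (x := [up i, up i]) (y := [up i, up i])
      (diff (sl [] (dotUp i) [up i] ≫ sl [] (crossUp i i) [])
        (sl [] (crossUp i i) [] ≫ sl [up i] (dotUp i) [])) (𝟙 _)
  | nilHecke₂ (μ : Weight n) (i : ZMod n) : Relator μ (x := [up i, up i]) (y := [up i, up i])
      (diff (sl [] (crossUp i i) [] ≫ sl [] (dotUp i) [up i])
        (sl [up i] (dotUp i) [] ≫ sl [] (crossUp i i) [])) (𝟙 _)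
  -- Reidemeister 3 for upward strands.
  | braid (μ : Weight n) (i j k : ZMod n) (h : ¬ (i = k ∧ (j = i + 1 ∨ i = j + 1))) :
      Relator μ (x := [up i, up j, up k]) (y := [up k, up j, up i])
      (sl [] (crossUp i j) [up k] ≫ sl [up j] (crossUp i k) [] ≫ sl [] (crossUp j k) [up i])
      (sl [up i] (crossUp j k) [] ≫ sl [] (crossUp i k) [up j] ≫ sl [up k] (crossUp i j) [])
  | braidSucc (μ : Weight n) (i : ZMod n) :
      Relator μ (x := [up i, up (i + 1), up i]) (y := [up i, up (i + 1), up i])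
      (diff
        (sl [] (crossUp i (i + 1)) [up i] ≫ sl [up (i + 1)] (crossUp i i) [] ≫
          sl [] (crossUp (i + 1) i) [up i])
        (sl [up i] (crossUp (i + 1) i) [] ≫ sl [] (crossUp i i) [up (i + 1)] ≫
          sl [up i] (crossUp i (i + 1)) []))
      (-𝟙 _)
  | braidPred (μ : Weight n) (i : ZMod n) :
      Relator μ (x := [up (i + 1), up i, up (i + 1)]) (y := [up (i + 1), up i, up (i + 1)])
      (diff
        (sl [] (crossUp (i + 1) i) [up (i + 1)] ≫ sl [up i] (crossUp (i + 1) (i + 1)) [] ≫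
          sl [] (crossUp i (i + 1)) [up (i + 1)])
        (sl [up (i + 1)] (crossUp i (i + 1)) [] ≫ sl [] (crossUp (i + 1) (i + 1)) [up i] ≫
          sl [up (i + 1)] (crossUp (i + 1) i) []))
      (𝟙 _)
  -- Reidemeister 2 for strands of different colours and opposite orientations.
  | mixed₁ (μ : Weight n) (i j : ZMod n) (hij : i ≠ j) :
      Relator μ (crossRight i j ≫ crossLeft i j) (𝟙 _)
  | mixed₂ (μ : Weight n) (i j : ZMod n) (hij : i ≠ j) :
      Relator μ (crossLeft i j ≫ crossRight i j) (𝟙 _)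
  -- Bubbles: negative degree, degree zero, infinite Grassmannian relation.
  | cwNeg (μ : Weight n) (i : ZMod n) (k : ℕ) (h : (k : ℤ) < bar μ i - 1) :
      Relator μ (x := []) (y := []) (cwBubble i k) 0
  | ccwNeg (μ : Weight n) (i : ZMod n) (k : ℕ) (h : (k : ℤ) < -bar μ i - 1) :
      Relator μ (x := []) (y := []) (ccwBubble i k) 0
  | cwZero (μ : Weight n) (i : ZMod n) (k : ℕ) (h : (k : ℤ) = bar μ i - 1) :
      Relator μ (x := []) (y := []) (cwBubble i k) (((-1 : ℚ) ^ (μ (i + 1))) • 𝟙 _)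
  | ccwZero (μ : Weight n) (i : ZMod n) (k : ℕ) (h : (k : ℤ) = -bar μ i - 1) :
      Relator μ (x := []) (y := []) (ccwBubble i k) (((-1 : ℚ) ^ (μ (i + 1) - 1)) • 𝟙 _)
  | grassmannian (μ : Weight n) (i : ZMod n) (α : ℕ) (h : 0 < α) :
      Relator μ (x := []) (y := [])
      (∑ a ∈ Finset.range (α + 1), (ccw μ i a ≫ cw μ i (α - a) : ob [] ⟶ ob [])) 0
  -- Curls.
  | curlRight (μ : Weight n) (i : ZMod n) : Relator μ (x := [up i]) (y := [up i])
      (sl [up i] (cupL i) [] ≫ sl [] (crossUp i i) [down i] ≫ sl [up i] (capR i) [])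
      (-∑ f ∈ Finset.range (-bar μ i + 1).toNat,
        (dots [] i ((-bar μ i).toNat - f) [] ≫ (whisker [up i] []).map (cw μ i f) :
          ob [up i] ⟶ ob [up i]))
  | curlLeft (μ : Weight n) (i : ZMod n) : Relator μ (x := [up i]) (y := [up i])
      (sl [] (cupR i) [up i] ≫ sl [down i] (crossUp i i) [] ≫ sl [] (capL i) [up i])
      (∑ g ∈ Finset.range (bar (μ + root i) i + 1).toNat,
        ((whisker [] [up i]).map (ccw (μ + root i) i g) ≫
          dots [] i ((bar (μ + root i) i).toNat - g) [] : ob [up i] ⟶ ob [up i]))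
  -- Decomposition of the identities of `E_i E_{-i}` and `E_{-i} E_i`.
  | decompUpDown (μ : Weight n) (i : ZMod n) :
      Relator μ (x := [up i, down i]) (y := [up i, down i]) (𝟙 _)
      (crossRight i i ≫ crossLeft i i
        - ∑ f ∈ Finset.range (bar μ i).toNat, ∑ g ∈ Finset.range (f + 1),
          (dots [] i ((bar μ i).toNat - 1 - f) [down i] ≫ sl [] (capR i) [] ≫ ccw μ i g ≫
            sl [] (cupL i) [] ≫ dots [] i (f - g) [down i] :
              ob [up i, down i] ⟶ ob [up i, down i]))
  | decompDownUp (μ : Weight n) (i : ZMod n) :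
      Relator μ (x := [down i, up i]) (y := [down i, up i]) (𝟙 _)
      (crossLeft i i ≫ crossRight i i
        - ∑ f ∈ Finset.range (-bar μ i).toNat, ∑ g ∈ Finset.range (f + 1),
          (dots [down i] i ((-bar μ i).toNat - 1 - f) [] ≫ sl [] (capL i) [] ≫ cw μ i g ≫
            sl [] (cupR i) [] ≫ dots [down i] i (f - g) [] :
              ob [down i, up i] ⟶ ob [down i, up i]))
  -- `E_{+δ}` and `E_{-δ}` are biadjoint and inverse to each other.
  | deltaZigzagUp₁ (μ : Weight n) : Relator μ (x := [dup]) (y := [dup])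
      (sl [] deltaCupL [dup] ≫ sl [dup] deltaCapL []) (𝟙 _)
  | deltaZigzagUp₂ (μ : Weight n) : Relator μ (x := [dup]) (y := [dup])
      (sl [dup] deltaCupR [] ≫ sl [] deltaCapR [dup]) (𝟙 _)
  | deltaZigzagDown₁ (μ : Weight n) : Relator μ (x := [ddown]) (y := [ddown])
      (sl [] deltaCupR [ddown] ≫ sl [ddown] deltaCapR []) (𝟙 _)
  | deltaZigzagDown₂ (μ : Weight n) : Relator μ (x := [ddown]) (y := [ddown])
      (sl [ddown] deltaCupL [] ≫ sl [] deltaCapL [ddown]) (𝟙 _)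
  | deltaBubbleCw : Relator (ones n) (x := []) (y := [])
      (sl [] deltaCupL [] ≫ sl [] deltaCapR []) (𝟙 _)
  | deltaBubbleCcw : Relator (ones n) (x := []) (y := [])
      (sl [] deltaCupR [] ≫ sl [] deltaCapL []) (𝟙 _)
  | deltaInvert₁ : Relator (ones n) (x := [ddown, dup]) (y := [ddown, dup])
      (sl [] deltaCapL [] ≫ sl [] deltaCupR []) (𝟙 _)
  | deltaInvert₂ : Relator (ones n) (x := [dup, ddown]) (y := [dup, ddown])
      (sl [] deltaCapR [] ≫ sl [] deltaCupL []) (𝟙 _)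
  -- Cyclicity of the splitters: both rotations of an upward one give the downward one.
  | mergeCyclic₁ (μ : Weight n) (i : ZMod n) :
      Relator μ (x := downs (colors i).reverse) (y := [ddown])
      (lay [] (mergeDown i) [] (by simp) rfl)
      (lay [] deltaCupR (downs (colors i).reverse)
          (y := ddown :: dup :: downs (colors i).reverse) rfl rfl ≫
        lay [ddown] (splitUp i) (downs (colors i).reverse)
          (y := ddown :: (ups (colors i) ++ downs (colors i).reverse)) rfl rfl ≫
        capsR (colors i) [ddown] [] (by simp) rfl)
  | mergeCyclic₂ (μ : Weight n) (i : ZMod n) :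
      Relator μ (x := downs (colors i).reverse) (y := [ddown])
      (lay [] (mergeDown i) [] (by simp) rfl)
      (lay (downs (colors i).reverse) deltaCupL []
          (y := downs (colors i).reverse ++ [dup, ddown]) (by simp) rfl ≫
        lay (downs (colors i).reverse) (splitUp i) [ddown]
          (y := downs (colors i).reverse ++ (ups (colors i) ++ [ddown])) rfl rfl ≫
        capsL (colors i) [] [ddown] rfl rfl)
  | splitCyclic₁ (μ : Weight n) (i : ZMod n) :
      Relator μ (x := [ddown]) (y := downs (colors i).reverse)
      (lay [] (splitDown i) [] rfl (by simp))
      (cupsR (colors i) [] [ddown]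
          (y := downs (colors i).reverse ++ (ups (colors i) ++ [ddown])) rfl rfl ≫
        lay (downs (colors i).reverse) (mergeUp i) [ddown]
          (y := downs (colors i).reverse ++ [dup, ddown]) rfl rfl ≫
        lay (downs (colors i).reverse) deltaCapR [] rfl (by simp))
  | splitCyclic₂ (μ : Weight n) (i : ZMod n) :
      Relator μ (x := [ddown]) (y := downs (colors i).reverse)
      (lay [] (splitDown i) [] rfl (by simp))
      (cupsL (colors i) [ddown] []
          (y := ddown :: (ups (colors i) ++ downs (colors i).reverse)) rfl (by simp) ≫
        lay [ddown] (mergeUp i) (downs (colors i).reverse)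
          (y := ddown :: dup :: downs (colors i).reverse) rfl rfl ≫
        lay [] deltaCapL (downs (colors i).reverse) rfl rfl)
  -- Moving the outermost strand of a splitter to the other side.  Here
  -- `colors i = (i, ..., i+2, i+1)` and `colors (i+1) = (i+1, i, ..., i+2)`.
  | splitPassLeft (μ : Weight n) (i : ZMod n) (L : List (ZMod n))
      (h : colors i = L ++ [i + 1]) (h' : colors (i + 1) = (i + 1) :: L) (M : List (ZMod n))
      (hM : L = i :: M) :
      Relator μ (x := [dup]) (y := up (i + 1) :: ups L)
      (lay [] (splitUp i) [] (y := ups L ++ [up (i + 1)]) rfl (by simp [h, ups]) ≫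
        passLeft (i + 1) L [] [] (by simp) (by simp))
      (lay [] (splitUp (i + 1)) [] rfl (by simp [h', ups]) ≫
        diff (lay [] (dotUp (i + 1)) (ups L) rfl rfl)
          (lay [up (i + 1)] (dotUp i) (ups M) (by simp [hM, ups]) (by simp [hM, ups])))
  | splitPassRight (μ : Weight n) (i : ZMod n) (L : List (ZMod n))
      (h : colors i = i :: L) (h' : colors (i - 1) = L ++ [i]) (M : List (ZMod n))
      (hM : L = M ++ [i + 1]) :
      Relator μ (x := [dup]) (y := ups L ++ [up i])
      (lay [] (splitUp i) [] (y := up i :: ups L) rfl (by simp [h, ups]) ≫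
        passRight i L [] [] (by simp) (by simp))
      (lay [] (splitUp (i - 1)) [] rfl (by simp [h', ups]) ≫
        diff (lay (ups M) (dotUp (i + 1)) [up i] (by simp [hM, ups]) (by simp [hM, ups]))
          (lay (ups L) (dotUp i) [] rfl rfl))
  | mergePassRight (μ : Weight n) (i : ZMod n) (L : List (ZMod n))
      (h : colors i = L ++ [i + 1]) (h' : colors (i + 1) = (i + 1) :: L) (M : List (ZMod n))
      (hM : L = i :: M) :
      Relator μ (x := up (i + 1) :: ups L) (y := [dup])
      (passRight (i + 1) L [] [] (y := ups L ++ [up (i + 1)]) (by simp) (by simp) ≫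
        lay [] (mergeUp i) [] (by simp [h, ups]) rfl)
      (diff (x := up (i + 1) :: ups L) (lay [] (dotUp (i + 1)) (ups L) rfl rfl)
          (lay [up (i + 1)] (dotUp i) (ups M) (by simp [hM, ups]) (by simp [hM, ups])) ≫
        lay [] (mergeUp (i + 1)) [] (by simp [h', ups]) rfl)
  | mergePassLeft (μ : Weight n) (i : ZMod n) (L : List (ZMod n))
      (h : colors i = i :: L) (h' : colors (i - 1) = L ++ [i]) (M : List (ZMod n))
      (hM : L = M ++ [i + 1]) :
      Relator μ (x := ups L ++ [up i]) (y := [dup])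
      (passLeft i L [] [] (y := up i :: ups L) (by simp) (by simp) ≫
        lay [] (mergeUp i) [] (by simp [h, ups]) rfl)
      (diff (y := ups L ++ [up i])
          (lay (ups M) (dotUp (i + 1)) [up i] (by simp [hM, ups]) (by simp [hM, ups]))
          (lay (ups L) (dotUp i) [] rfl rfl) ≫
        lay [] (mergeUp (i - 1)) [] (by simp [h', ups]) rfl)
  -- A downward strand next to a delta-strand.
  | deltaDown (μ : Weight n) (i : ZMod n) (L : List (ZMod n)) (h : colors (i - 1) = L ++ [i]) :
      Relator μ (x := [dup, down i]) (y := [dup, down i])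
      (lay [] (splitUp (i - 1)) [down i] (y := ups L ++ [up i, down i]) rfl
          (by simp [h, ups]) ≫
        lay (ups L) (capR i) [] (y := ups L) rfl (by simp) ≫
        lay (ups L) (cupL i) [] (y := ups L ++ [up i, down i]) (by simp) rfl ≫
        lay [] (mergeUp (i - 1)) [down i] (by simp [h, ups]) rfl)
      (𝟙 _)
  | downDelta (μ : Weight n) (i : ZMod n) (L : List (ZMod n)) (h : colors i = i :: L) :
      Relator μ (x := [down i, dup]) (y := [down i, dup])
      (lay [down i] (splitUp i) [] (y := down i :: up i :: ups L) rfl (by simp [h, ups]) ≫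
        lay [] (capL i) (ups L) (y := ups L) rfl rfl ≫
        lay [] (cupR i) (ups L) (y := down i :: up i :: ups L) rfl rfl ≫
        lay [down i] (mergeUp i) [] (by simp [h, ups]) rfl)
      (𝟙 _)
  -- A merge followed by a split.
  | mergeSplitSame (i : ZMod n) (L : List (ZMod n)) (h : colors i = i :: (L ++ [i + 1])) :
      Relator (ones n) (x := up i :: (ups L ++ [up (i + 1)]))
        (y := up i :: (ups L ++ [up (i + 1)]))
      (lay [] (mergeUp i) [] (y := [dup]) (by simp [h, ups]) rfl ≫
        lay [] (splitUp i) [] rfl (by simp [h, ups]))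
      (diff (lay (up i :: ups L) (dotUp (i + 1)) [] rfl rfl)
        (lay [] (dotUp i) (ups L ++ [up (i + 1)]) rfl rfl))
  | mergeSplitDifferent (i j : ZMod n) (hij : i ≠ j) (L M : List (ZMod n))
      (h : colors i = L ++ M) (h' : colors j = M ++ L) :
      Relator (ones n) (x := ups L ++ ups M) (y := ups M ++ ups L)
      (lay [] (mergeUp i) [] (y := [dup]) (by simp [h, ups]) rfl ≫
        lay [] (splitUp j) [] rfl (by simp [h', ups]))
      (blockCross L M [] [] (by simp) (by simp))

/-! ### The 2-category -/

/-- The relations among diagrams with rightmost label `μ`: the part, in the space of linear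
combinations of diagrams from `x` to `y`, of the two-sided ideal generated by the defining
relations under vertical and horizontal composition. -/
def ideal {n : ℕ} (μ : Weight n) (x y : Diag n) : Submodule ℚ (x ⟶ y) :=
  Submodule.span ℚ {h | ∃ (a b u v : Word n) (f g : ob u ⟶ ob v)
    (p : x ⟶ (whisker a b).obj (ob u)) (q : (whisker a b).obj (ob v) ⟶ y),
    Relator (leftWeight b μ) f g ∧ h = p ≫ (whisker a b).map (f - g) ≫ q}

/-- Two linear combinations of diagrams are equal modulo the ideal. -/
def rel {n : ℕ} (μ : Weight n) : HomRel (Diag n) := fun x y f g => f - g ∈ ideal μ x y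

theorem comp_mem_ideal {n : ℕ} {μ : Weight n} {x y z : Diag n} (p : x ⟶ y) {h : y ⟶ z}
    (hh : h ∈ ideal μ y z) : p ≫ h ∈ ideal μ x z := by
  induction hh using Submodule.span_induction with
  | mem h hh =>
    obtain ⟨a, b, u, v, f, g, p', q, hr, rfl⟩ := hh
    exact Submodule.subset_span ⟨a, b, u, v, f, g, p ≫ p', q, hr, by simp⟩
  | zero => simp
  | add h₁ h₂ _ _ ih₁ ih₂ => rw [Preadditive.comp_add]; exact add_mem ih₁ ih₂
  | smul c h _ ih => rw [Linear.comp_smul]; exact Submodule.smul_mem _ _ ih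

theorem mem_ideal_comp {n : ℕ} {μ : Weight n} {x y z : Diag n} {h : x ⟶ y} (q : y ⟶ z)
    (hh : h ∈ ideal μ x y) : h ≫ q ∈ ideal μ x z := by
  induction hh using Submodule.span_induction with
  | mem h hh =>
    obtain ⟨a, b, u, v, f, g, p, q', hr, rfl⟩ := hh
    exact Submodule.subset_span ⟨a, b, u, v, f, g, p, q' ≫ q, hr, by simp⟩
  | zero => simp
  | add h₁ h₂ _ _ ih₁ ih₂ => rw [Preadditive.add_comp]; exact add_mem ih₁ ih₂
  | smul c h _ ih => rw [Linear.smul_comp]; exact Submodule.smul_mem _ _ ih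

instance congruence_rel {n : ℕ} (μ : Weight n) : Congruence (rel μ) where
  equivalence :=
    { refl := fun f => by simp [rel]
      symm := fun {f g} h => by
        have := neg_mem h
        rwa [neg_sub] at this
      trans := fun {f g k} h₁ h₂ => by
        have := add_mem h₁ h₂
        rwa [sub_add_sub_cancel] at this }
  comp_left p _ _ h := by
    have := comp_mem_ideal p h
    rwa [Preadditive.comp_sub] at this
  comp_right q h := by
    have := mem_ideal_comp q h
    rwa [Preadditive.sub_comp] at this

/-- The category of all 1-morphisms with source `μ` (words with rightmost label `μ`) and their
2-morphisms of arbitrary degree, in the 2-category `Ŝ(n,n)`.  The 1-morphisms with source `μ` and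
target `ν` are the words `w` with `leftWeight w μ = ν`. -/
abbrev Schur (n : ℕ) (μ : Weight n) : Type := Quotient (rel μ)

theorem rel_add {n : ℕ} (μ : Weight n) ⦃x y : Diag n⦄ (f₁ f₂ g₁ g₂ : x ⟶ y)
    (h : rel μ f₁ f₂) (h' : rel μ g₁ g₂) : rel μ (f₁ + g₁) (f₂ + g₂) := by
  have := add_mem h h'
  rwa [← add_sub_add_comm] at this

instance schurPreadditive (n : ℕ) (μ : Weight n) : Preadditive (Schur n μ) :=
  Quotient.preadditive (rel μ) (rel_add μ)

instance schurFunctorAdditive (n : ℕ) (μ : Weight n) : (Quotient.functor (rel μ)).Additive :=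
  Quotient.functor_additive (rel μ) (rel_add μ)

instance schurLinear (n : ℕ) (μ : Weight n) : Linear ℚ (Schur n μ) :=
  Quotient.linear ℚ (rel μ) (fun a x y f g h => by
    have := Submodule.smul_mem (ideal μ x y) a h
    rwa [smul_sub] at this)

/-- The 1-morphism given by a word with rightmost label `μ`. -/
def oneMor {n : ℕ} (μ : Weight n) (w : Word n) : Schur n μ := (Quotient.functor (rel μ)).obj (ob w)

/-- The 2-morphism represented by a linear combination of diagrams with rightmost
label `μ`. -/
def twoMor {n : ℕ} (μ : Weight n) {x y : Word n} (f : ob x ⟶ ob y) : oneMor μ x ⟶ oneMor μ y :=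
  (Quotient.functor (rel μ)).map f

/-! ### The ingredients of the bubble slides -/

/-- A closed diagram placed to the left of an upward delta-strand. -/
def leftOfDelta {n : ℕ} (f : End (ob ([] : Word n))) : ob ([dup] : Word n) ⟶ ob [dup] :=
  (whisker [] [dup]).map f

/-- A closed diagram placed to the right of an upward delta-strand. -/
def rightOfDelta {n : ℕ} (f : End (ob ([] : Word n))) : ob ([dup] : Word n) ⟶ ob [dup] :=
  (whisker [dup] []).map f

/-- Minus the sum of the undotted counterclockwise bubbles of colours `i-1, i-2, ..., m`
(modulo `n`); it is zero for `m = i`. -/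
def zBox {n : ℕ} (i m : ZMod n) : End (ob ([] : Word n)) :=
  -∑ k ∈ Finset.range (i - m).val, (ccwBubble (i - 1 - k) 0 : ob ([] : Word n) ⟶ ob [])

/-- The sum of the undotted clockwise bubbles of colours `m, m-1, ..., i+2` (modulo `n`); it is
zero for `m = i+1`. -/
def yBox {n : ℕ} (i m : ZMod n) : End (ob ([] : Word n)) :=
  ∑ k ∈ Finset.range (m - (i + 1)).val, (cwBubble (i + 2 + k) 0 : ob ([] : Word n) ⟶ ob [])

end AffineSchur

end

open AffineSchur

/-!
Fix a colour `i` and write `S : E_δ → E_i E_{i-1} ⋯ E_{i+1}` and `M` for the two splitters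
`split` and `merge` (composites are read from bottom to top, so `S ≫ M` starts with `S`).  Let
`A` and `B` be a dot on the first strand (of colour `i`) and on the last strand (of colour
`i + 1`) of the split word; they commute.

*Dotted bubbles become dots.*  A clockwise `i`-bubble with `k` dots to the left of the
delta-strand equals `S ≫ A ^ k ≫ M` (`leftOf_cwBubble`), and a counterclockwise `(i+1)`-bubble
with `k` dots to its right equals `S ≫ B ^ k ≫ M` (`rightOf_ccwBubble`): the relations for a
downward strand next to a delta-strand insert a cap and a cup, and zigzags straighten the result.
For `k = 0` both are `S ≫ M`.  Since undotted clockwise and counterclockwise bubbles agree in the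
region `(1^n)`, an undotted bubble of colour `c` on the left of the delta-strand is an undotted
bubble of colour `c + 1` on its right (`leftOf_ccwBubble_zero`).

*Undotted bubbles become differences of dots.*  Let `x_p` be a dot on the strand in position `p`
of the split word, so that `A = x_0` and `B = x_{n-1}`.  An undotted bubble of colour
`c = i - p`, `p < n - 1`, on the right satisfies `bubble ≫ S = S ≫ (x_p - x_{p+1})`
(`rightOf_ccwBubble_split`).  For `p = 0` this follows from writing the bubble as the composite of
the two splitters for the colour `i - 1`: the merger followed by `S` passes one strand through
the others, and the relation for a splitter followed by that crossing gives the two dots.  For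
`p ≥ 1` the bubble is pulled through the strands of the split word from the right.  All colours
that it meets are distant from `c` until it reaches the strands of colours `c, c - 1`.  There the
region `ν` on the left has `ν_c = 1` and `ν_{c+1} = 0`, so that `E_{-c} E_c` vanishes and the
identity of `E_c E_{-c}` factors through the identity 1-morphism (`W_capR_cupL`); cutting the
bubble open along this factorisation turns it into a double crossing of the two strands, which is
`x_p - x_{p+1}` (`W_ccwBubble_pair`).

*Conclusion.*  The bubbles in `y_i`, and those in `z_{i+1}` after passing from the left to the
right of the delta-strand, are the bubbles of colours `i - p` with `p = 0, …, n - 2`, so the sums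
telescope: `Z ≫ S = S ≫ (B - A)` for `Z` the box `z_{i+1}` on the left of the delta-strand, and
`Y ≫ S = S ≫ (A - B)` for `Y` the box `y_i` on its right.  Hence the first left hand side is
`∑ (s choose j) S ≫ (B - A) ^ j A ^ (s - j) ≫ M = S ≫ B ^ s ≫ M` by the binomial theorem
(`sum_choose_comp`), which is the right hand side.  The second identity is obtained in the same
way with `A` and `B` exchanged.
-/

open CategoryTheory

noncomputable section

namespace AffineSchur

open Strand Gen

variable {n : ℕ}

/-! ### Identity strands next to a diagram -/

theorem leftWeight_append (a b : Word n) (μ : Weight n) :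
    leftWeight (a ++ b) μ = leftWeight a (leftWeight b μ) := by
  induction a with
  | nil => rfl
  | cons s a ih => simp [leftWeight, ih]

/-- `whisker a b` applied to a diagram, with source and target given only up to an equality of
words.  This avoids transporting along the associativity of concatenation. -/
def wh (a b : Word n) {u v : Word n} (f : ob u ⟶ ob v) {x y : Word n}
    (hx : x = a ++ (u ++ b)) (hy : y = a ++ (v ++ b)) : ob x ⟶ ob y :=
  eqToHom (congrArg ob hx) ≫ (whisker a b).map f ≫ eqToHom (congrArg ob hy.symm)

theorem wh_rfl (a b : Word n) {u v : Word n} (f : ob u ⟶ ob v) :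
    wh a b f rfl rfl = (whisker a b).map f :=
  (Category.id_comp _).trans (Category.comp_id _)

theorem wh_lay (a b : Word n) {a' b' u v x y : Word n} (g : Gen n u v)
    (hx : x = a' ++ (u ++ b')) (hy : y = a' ++ (v ++ b')) {x' y' : Word n}
    (hx' : x' = a ++ (x ++ b)) (hy' : y' = a ++ (y ++ b)) :
    wh a b (lay a' g b' hx hy) hx' hy' =
      lay (a ++ a') g (b' ++ b) (by simp [hx, hx']) (by simp [hy, hy']) := by
  subst hx' hy'
  rw [wh_rfl]
  refine (Free.lift_map_single ℚ (Paths.lift (whiskerPre n a b)) _ _).trans ?_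
  rw [one_smul]
  refine (Paths.lift_toPath (whiskerPre n a b) _).trans ?_
  rfl

theorem wh_comp (a b : Word n) {u v w : Word n} (f : ob u ⟶ ob v) (g : ob v ⟶ ob w)
    {x y z : Word n} (hx : x = a ++ (u ++ b)) (hy : y = a ++ (v ++ b))
    (hz : z = a ++ (w ++ b)) :
    wh a b (f ≫ g) hx hz = wh a b f hx hy ≫ wh a b g hy hz := by
  subst hx hy hz
  simp only [wh_rfl]
  exact (whisker a b).map_comp f g

theorem wh_id (a b : Word n) {u x : Word n} (hx hx' : x = a ++ (u ++ b)) :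
    wh a b (𝟙 (ob u)) hx hx' = 𝟙 (ob x) := by
  subst hx
  rw [wh_rfl]
  exact (whisker a b).map_id _

instance whiskerAdditive (a b : Word n) : (whisker (n := n) a b).Additive := by
  unfold whisker; infer_instance

instance whiskerLinear (a b : Word n) : (whisker (n := n) a b).Linear ℚ := by
  unfold whisker; infer_instance

section

variable (a b : Word n) {u v x y : Word n} (hx : x = a ++ (u ++ b)) (hy : y = a ++ (v ++ b))

theorem wh_add (f g : ob u ⟶ ob v) : wh a b (f + g) hx hy = wh a b f hx hy + wh a b g hx hy := by
  subst hx hy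
  simp only [wh_rfl]
  exact (whisker a b).map_add

theorem wh_sub (f g : ob u ⟶ ob v) : wh a b (f - g) hx hy = wh a b f hx hy - wh a b g hx hy := by
  subst hx hy
  simp only [wh_rfl]
  exact (whisker a b).map_sub

theorem wh_neg (f : ob u ⟶ ob v) : wh a b (-f) hx hy = -wh a b f hx hy := by
  subst hx hy
  simp only [wh_rfl]
  exact (whisker a b).map_neg

theorem wh_smul (c : ℚ) (f : ob u ⟶ ob v) : wh a b (c • f) hx hy = c • wh a b f hx hy := by
  subst hx hy
  simp only [wh_rfl]
  exact (whisker a b).map_smul _ _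

theorem wh_zero : wh a b (0 : ob u ⟶ ob v) hx hy = 0 := by
  subst hx hy
  rw [wh_rfl]
  exact (whisker a b).map_zero _ _

theorem wh_sum {ι : Type*} (s : Finset ι) (f : ι → (ob u ⟶ ob v)) :
    wh a b (∑ k ∈ s, f k) hx hy = ∑ k ∈ s, wh a b (f k) hx hy := by
  subst hx hy
  simp only [wh_rfl]
  exact (whisker a b).map_sum _ _

end

/-- A property of linear combinations of diagrams that is compatible with the linear structure
and with vertical composition only has to be checked on single generators with identity strands
next to them. -/
theorem diag_induction {P : ∀ {x y : Word n}, (ob x ⟶ ob y) → Prop}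
    (zero : ∀ x y : Word n, P (0 : ob x ⟶ ob y))
    (add : ∀ {x y : Word n} (f g : ob x ⟶ ob y), P f → P g → P (f + g))
    (smul : ∀ {x y : Word n} (c : ℚ) (f : ob x ⟶ ob y), P f → P (c • f))
    (id : ∀ x : Word n, P (𝟙 (ob x)))
    (comp : ∀ {x y z : Word n} (f : ob x ⟶ ob y) (g : ob y ⟶ ob z), P f → P g → P (f ≫ g))
    (gen : ∀ {x y u v a b : Word n} (g : Gen n u v) (hx : x = a ++ (u ++ b))
      (hy : y = a ++ (v ++ b)), P (lay a g b hx hy))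
    {x y : Word n} (f : ob x ⟶ ob y) : P f := by
  refine Finsupp.induction_linear (motive := fun f : ob x ⟶ ob y => P f) f (zero x y)
    (fun f g hf hg => add f g hf hg) ?_
  intro p r
  have h1 : (Finsupp.single p r : ob x ⟶ ob y) =
      r • (Free.embedding ℚ (Paths (Word n))).map p := by
    simp [Free.embedding]
    exact (Finsupp.smul_single_one p r).symm
  rw [h1]
  refine smul _ _ ?_
  clear h1 f
  have key : ∀ (z : Word n) (p : Quiver.Path x z),
      @P x z ((Free.embedding ℚ (Paths (Word n))).map p) := by
    intro z p
    induction p with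
    | nil => exact id x
    | @cons u v p q ih =>
      have e : (Free.embedding ℚ (Paths (Word n))).map (p.cons q) = (_ : ob x ⟶ ob v) :=
        (Free.embedding ℚ (Paths (Word n))).map_comp p ((Paths.of (Word n)).map q)
      obtain ⟨a, b, u', v', g, hx, hy⟩ := q
      exact e ▸ comp _ _ ih (gen g hx hy)
  exact key y p

theorem wh_nil_nil {u v : Word n} (f : ob u ⟶ ob v) (hx : u = [] ++ (u ++ []))
    (hy : v = [] ++ (v ++ [])) : wh [] [] f hx hy = f := by
  induction f using diag_induction with
  | zero => rw [wh_zero]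
  | add f g hf hg => rw [wh_add, hf, hg]
  | smul c f hf => rw [wh_smul, hf]
  | id u => rw [wh_id]
  | comp f g hf hg => rw [wh_comp [] [] f g hx (List.append_nil _).symm hy, hf, hg]
  | gen g h h' => simp only [wh_lay, List.append_nil, List.nil_append]

theorem wh_wh (a b a' b' : Word n) {u v x y x' y' : Word n} (f : ob u ⟶ ob v)
    (hx : x = a' ++ (u ++ b')) (hy : y = a' ++ (v ++ b'))
    (hx' : x' = a ++ (x ++ b)) (hy' : y' = a ++ (y ++ b)) :
    wh a b (wh a' b' f hx hy) hx' hy' =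
      wh (a ++ a') (b' ++ b) f (by simp [hx, hx']) (by simp [hy, hy']) := by
  induction f using diag_induction generalizing x y x' y' with
  | zero => simp only [wh_zero]
  | add f g hf hg => simp only [wh_add, hf, hg]
  | smul c f hf => simp only [wh_smul, hf]
  | id u =>
    obtain rfl : x = y := hx.trans hy.symm
    obtain rfl : x' = y' := hx'.trans hy'.symm
    rw [wh_id, wh_id, wh_id]
  | comp f g hf hg =>
    rw [wh_comp a' b' f g hx rfl hy, wh_comp a b _ _ hx' rfl hy', hf, hg, wh_comp]
  | gen g h h' =>
    simp only [wh_lay, List.append_assoc]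

/-! ### The quotient by the relations -/

theorem twoMor_eq_iff {μ : Weight n} {x y : Word n} {f g : ob x ⟶ ob y} :
    twoMor μ f = twoMor μ g ↔ rel μ f g :=
  Quotient.functor_map_eq_iff (rel μ) f g

section

variable {μ : Weight n} {x y z : Word n}

theorem twoMor_comp (f : ob x ⟶ ob y) (g : ob y ⟶ ob z) :
    twoMor μ (f ≫ g) = twoMor μ f ≫ twoMor μ g := Functor.map_comp _ _ _

theorem twoMor_id : twoMor μ (𝟙 (ob x)) = 𝟙 (oneMor μ x) :=
  CategoryTheory.Functor.map_id _ _

theorem twoMor_add (f g : ob x ⟶ ob y) : twoMor μ (f + g) = twoMor μ f + twoMor μ g :=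
  Functor.map_add _

theorem twoMor_sub (f g : ob x ⟶ ob y) : twoMor μ (f - g) = twoMor μ f - twoMor μ g :=
  Functor.map_sub _

theorem twoMor_neg (f : ob x ⟶ ob y) : twoMor μ (-f) = -twoMor μ f :=
  Functor.map_neg _

theorem twoMor_zero : twoMor μ (0 : ob x ⟶ ob y) = 0 := Functor.map_zero _ _ _

theorem twoMor_sum {ι : Type*} (s : Finset ι) (f : ι → (ob x ⟶ ob y)) :
    twoMor μ (∑ k ∈ s, f k) = ∑ k ∈ s, twoMor μ (f k) :=
  Functor.map_sum _ _ _

theorem twoMor_smul (c : ℚ) (f : ob x ⟶ ob y) : twoMor μ (c • f) = c • twoMor μ f := by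
  have := Quotient.linear_functor ℚ (rel μ) (fun a x y f g h => by
    have := Submodule.smul_mem (ideal μ x y) a h
    rwa [smul_sub] at this)
  exact Functor.map_smul (Quotient.functor (rel μ)) c f

end

theorem Relator.twoMor_eq {μ : Weight n} {x y : Word n} {f g : ob x ⟶ ob y}
    (h : Relator μ f g) : twoMor μ f = twoMor μ g := by
  rw [twoMor_eq_iff]
  refine Submodule.subset_span ⟨[], [], x, y, f, g, eqToHom (congrArg ob (List.append_nil x).symm),
    eqToHom (congrArg ob (List.append_nil y)), h, ?_⟩
  exact (wh_nil_nil (f - g) (by simp) (by simp)).symm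

theorem comp_comp_assoc {C : Type*} [Category C] {s t u v w x : C} (p : s ⟶ t) (e : t ⟶ u)
    (k : u ⟶ v) (e' : v ⟶ w) (q : w ⟶ x) :
    p ≫ (e ≫ k ≫ e') ≫ q = (p ≫ e) ≫ k ≫ e' ≫ q := by
  simp only [Category.assoc]

/-- Horizontal composition with identity strands is well defined on 2-morphisms.  The region to the
right of the inner diagram is labelled `leftWeight b μ`. -/
theorem twoMor_wh_congr {μ : Weight n} (a b : Word n) {u v : Word n} {f g : ob u ⟶ ob v}
    (h : twoMor (leftWeight b μ) f = twoMor (leftWeight b μ) g) {x y : Word n}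
    (hx : x = a ++ (u ++ b)) (hy : y = a ++ (v ++ b)) :
    twoMor μ (wh a b f hx hy) = twoMor μ (wh a b g hx hy) := by
  rw [twoMor_eq_iff, rel] at h ⊢
  rw [← wh_sub]
  generalize f - g = k at h
  subst hx hy
  rw [wh_rfl]
  change k ∈ ideal (leftWeight b μ) (ob u) (ob v) at h
  induction h using Submodule.span_induction with
  | mem h hh =>
    obtain ⟨a', b', u', v', f, g, p, q, hr, rfl⟩ := hh
    rw [← leftWeight_append] at hr
    have e : ∀ w : Word n, a ++ (a' ++ (w ++ b') ++ b) = a ++ a' ++ (w ++ (b' ++ b)) := by simp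
    refine Submodule.subset_span ⟨a ++ a', b' ++ b, u', v', f, g,
      (whisker a b).map p ≫ eqToHom (congrArg ob (e u')),
      eqToHom (congrArg ob (e v').symm) ≫ (whisker a b).map q, hr, ?_⟩
    have := wh_wh a b a' b' (f - g) rfl rfl rfl rfl
    rw [wh_rfl, wh_rfl] at this
    rw [(whisker a b).map_comp, (whisker a b).map_comp]
    refine (congrArg (fun t => _ ≫ t ≫ _) this).trans ?_
    exact comp_comp_assoc _ _ _ _ _
  | zero => rw [Functor.map_zero]; exact zero_mem _
  | add h₁ h₂ _ _ ih₁ ih₂ => rw [Functor.map_add]; exact add_mem ih₁ ih₂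
  | smul c h _ ih => rw [Functor.map_smul]; exact Submodule.smul_mem _ _ ih

/-- The interchange law for arbitrary linear combinations of diagrams: `f` on the strands `u` and
`f'` on the strands `u'`, which lie to the right of `u` and of the strands `m`. -/
theorem twoMor_interchange (μ : Weight n) {u v u' v' : Word n} (f : ob u ⟶ ob v)
    (f' : ob u' ⟶ ob v') (a m b : Word n) {x y y' z c d c' d' : Word n}
    (h₁ : x = a ++ (u ++ c)) (h₂ : y = a ++ (v ++ c)) (h₃ : y = d ++ (u' ++ b))
    (h₄ : z = d ++ (v' ++ b)) (h₃' : y' = a ++ (u ++ c')) (h₄' : z = a ++ (v ++ c'))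
    (h₁' : x = d' ++ (u' ++ b)) (h₂' : y' = d' ++ (v' ++ b))
    (hc : c = m ++ (u' ++ b)) (hd : d = a ++ (v ++ m)) (hc' : c' = m ++ (v' ++ b))
    (hd' : d' = a ++ (u ++ m)) :
    twoMor μ (wh a c f h₁ h₂ ≫ wh d b f' h₃ h₄) =
      twoMor μ (wh d' b f' h₁' h₂' ≫ wh a c' f h₃' h₄') := by
  obtain rfl := hc
  obtain rfl := hd
  obtain rfl := hc'
  obtain rfl := hd'
  induction f using diag_induction generalizing u' v' x y y' z with
  | zero => simp only [wh_zero, Limits.zero_comp, Limits.comp_zero]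
  | add f g hf hg =>
    have h1 := hf f' h₁ h₂ h₃ h₄ h₃' h₄' h₁' h₂'
    have h2 := hg f' h₁ h₂ h₃ h₄ h₃' h₄' h₁' h₂'
    rw [wh_add, wh_add, Preadditive.add_comp, Preadditive.comp_add, twoMor_add, twoMor_add, h1, h2]
  | smul k f hf =>
    have h1 := hf f' h₁ h₂ h₃ h₄ h₃' h₄' h₁' h₂'
    rw [wh_smul, wh_smul, Linear.smul_comp, Linear.comp_smul, twoMor_smul, twoMor_smul, h1]
  | id u =>
    obtain rfl : x = y := h₁.trans h₂.symm
    obtain rfl : y' = z := h₃'.trans h₄'.symm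
    rw [wh_id, wh_id, Category.id_comp, Category.comp_id]
  | @comp u v w f g hf hg =>
    rw [wh_comp a _ f g h₁ rfl h₂, wh_comp a _ f g h₃' rfl h₄', Category.assoc, twoMor_comp,
      hg f' rfl h₂ h₃ h₄ (y' := a ++ (v ++ (m ++ (v' ++ b)))) rfl h₄' (by simp) (by simp),
      ← twoMor_comp, ← Category.assoc, twoMor_comp,
      hf f' h₁ rfl (by simp) (by simp) h₃' rfl h₁' h₂', ← twoMor_comp, Category.assoc]
  | @gen u v u₀ v₀ p q g hu hv =>
    induction f' using diag_induction generalizing x y y' z with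
    | zero => simp only [wh_zero, Limits.zero_comp, Limits.comp_zero]
    | add f f' hf hf' =>
      have h1 := hf h₁ h₂ h₃ h₄ h₃' h₄' h₁' h₂'
      have h2 := hf' h₁ h₂ h₃ h₄ h₃' h₄' h₁' h₂'
      rw [wh_add, wh_add, Preadditive.add_comp, Preadditive.comp_add, twoMor_add, twoMor_add,
        h1, h2]
    | smul k f hf =>
      have h1 := hf h₁ h₂ h₃ h₄ h₃' h₄' h₁' h₂'
      rw [wh_smul, wh_smul, Linear.smul_comp, Linear.comp_smul, twoMor_smul, twoMor_smul, h1]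
    | id w =>
      obtain rfl : x = y' := h₁'.trans h₂'.symm
      obtain rfl : y = z := h₃.trans h₄.symm
      rw [wh_id, wh_id, Category.id_comp, Category.comp_id]
    | @comp r s t f f' hf hf' =>
      rw [wh_comp _ b f f' h₃ rfl h₄, wh_comp _ b f f' h₁' rfl h₂', ← Category.assoc, twoMor_comp,
        hf h₁ h₂ h₃ rfl (y' := a ++ (u ++ m) ++ (s ++ b)) (by simp) (by simp) h₁' rfl,
        ← twoMor_comp, Category.assoc, twoMor_comp, hf' _ _ rfl h₄ h₃' h₄' rfl h₂',
        ← twoMor_comp, Category.assoc]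
    | @gen u' v' u₁ v₁ p' q' g' hu' hv' =>
      subst hu hv hu' hv'
      have h := twoMor_wh_congr (μ := μ) (a ++ p) (q' ++ b)
        (Relator.interchange (leftWeight (q' ++ b) μ) g (q ++ (m ++ p')) g').twoMor_eq
        (x := x) (y := z) (by simp [h₁]) (by simp [h₄])
      rw [wh_comp _ _ _ _ _ (by simp [h₂] : y = _), wh_comp _ _ _ _ _ (by simp [h₂'] : y' = _)] at h
      simp only [wh_lay] at h ⊢
      simpa using h

/-! ### 2-morphisms with identity strands next to them -/

/-- The diagram consisting of a single generator. -/
def gn {u v : Word n} (g : Gen n u v) : ob u ⟶ ob v := lay [] g [] (by simp) (by simp)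

theorem lay_eq_wh {a b u v x y : Word n} (g : Gen n u v) (hx : x = a ++ (u ++ b))
    (hy : y = a ++ (v ++ b)) : lay a g b hx hy = wh a b (gn g) hx hy := by
  simp only [gn, wh_lay, List.append_nil, List.nil_append]

/-- The 2-morphism represented by a diagram `f` with identity strands `a` on its left and `b` on
its right.  The equations for source and target keep composites of such 2-morphisms well typed
without casts. -/
def W (μ : Weight n) (x y a : Word n) {u v : Word n} (f : ob u ⟶ ob v) (b : Word n)
    (hx : x = a ++ (u ++ b) := by first | (simp; done) | (simp; assumption) | (subst_vars; simp))
    (hy : y = a ++ (v ++ b) := by first | (simp; done) | (simp; assumption) | (subst_vars; simp)) :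
    oneMor μ x ⟶ oneMor μ y :=
  twoMor μ (wh a b f hx hy)

section

variable (μ : Weight n) (a b : Word n) {u v w x y z : Word n}

theorem twoMor_lay (g : Gen n u v) (hx : x = a ++ (u ++ b)) (hy : y = a ++ (v ++ b)) :
    twoMor μ (lay a g b hx hy) = W μ x y a (gn g) b hx hy := by
  rw [lay_eq_wh]; rfl

theorem W_lay {a' b' u' v' : Word n} (g : Gen n u' v') (hu : u = a' ++ (u' ++ b'))
    (hv : v = a' ++ (v' ++ b')) (hx : x = a ++ (u ++ b)) (hy : y = a ++ (v ++ b)) :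
    W μ x y a (lay a' g b' hu hv) b hx hy =
      W μ x y (a ++ a') (gn g) (b' ++ b) (by simp [hx, hu]) (by simp [hy, hv]) := by
  rw [W, wh_lay, twoMor_lay]

theorem W_wh {a' b' u' v' : Word n} (f : ob u' ⟶ ob v') (hu : u = a' ++ (u' ++ b'))
    (hv : v = a' ++ (v' ++ b')) (hx : x = a ++ (u ++ b)) (hy : y = a ++ (v ++ b)) :
    W μ x y a (wh a' b' f hu hv) b hx hy =
      W μ x y (a ++ a') f (b' ++ b) (by simp [hx, hu]) (by simp [hy, hv]) := by
  rw [W, wh_wh]; rfl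

theorem W_comp (f : ob u ⟶ ob v) (g : ob v ⟶ ob w) (hx : x = a ++ (u ++ b))
    (hz : z = a ++ (w ++ b)) (hy : y = a ++ (v ++ b)) :
    W μ x z a (f ≫ g) b hx hz = W μ x y a f b hx hy ≫ W μ y z a g b hy hz := by
  rw [W, wh_comp a b f g hx hy hz, twoMor_comp]; rfl

theorem W_id (hx hy : x = a ++ (u ++ b)) : W μ x x a (𝟙 (ob u)) b hx hy = 𝟙 (oneMor μ x) := by
  rw [W, wh_id, twoMor_id]

variable {μ b} in
theorem W_congr {f g : ob u ⟶ ob v} (h : twoMor (leftWeight b μ) f = twoMor (leftWeight b μ) g)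
    (hx : x = a ++ (u ++ b)) (hy : y = a ++ (v ++ b)) : W μ x y a f b hx hy = W μ x y a g b hx hy :=
  twoMor_wh_congr a b h hx hy

/-- `twoMor_interchange` for `W`: `f` acts on strands to the left of `f'`, and the strands `m` lie
between them. -/
theorem W_interchange {u' v' y' c d c' d' : Word n} (m : Word n) (f : ob u ⟶ ob v)
    (f' : ob u' ⟶ ob v')
    {h₁ : x = a ++ (u ++ c)} {h₂ : y = a ++ (v ++ c)} {h₃ : y = d ++ (u' ++ b)}
    {h₄ : z = d ++ (v' ++ b)} {h₃' : y' = a ++ (u ++ c')} {h₄' : z = a ++ (v ++ c')}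
    {h₁' : x = d' ++ (u' ++ b)} {h₂' : y' = d' ++ (v' ++ b)}
    (hc : c = m ++ (u' ++ b) := by first | (simp; done) | simp [*])
    (hd : d = a ++ (v ++ m) := by first | (simp; done) | simp [*])
    (hc' : c' = m ++ (v' ++ b) := by first | (simp; done) | simp [*])
    (hd' : d' = a ++ (u ++ m) := by first | (simp; done) | simp [*]) :
    W μ x y a f c h₁ h₂ ≫ W μ y z d f' b h₃ h₄ =
      W μ x y' d' f' b h₁' h₂' ≫ W μ y' z a f c' h₃' h₄' := by
  have := twoMor_interchange μ f f' a m b h₁ h₂ h₃ h₄ h₃' h₄' h₁' h₂' hc hd hc' hd'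
  rwa [twoMor_comp, twoMor_comp] at this

theorem W_zigzagUp₁ (i : ZMod n) {a' b' : Word n}
    {h₁ : x = a ++ ([] ++ b')} {h₂ : y = a ++ ([up i, down i] ++ b')}
    {h₃ : y = a' ++ ([down i, up i] ++ b)} {h₄ : x = a' ++ ([] ++ b)}
    (ha : a' = a ++ [up i] := by first | (simp; done) | simp [*])
    (hb : b' = up i :: b := by first | (simp; done) | simp [*]) :
    W μ x y a (gn (cupL i)) b' h₁ h₂ ≫ W μ y x a' (gn (capL i)) b h₃ h₄ = 𝟙 _ := by
  subst ha hb
  have := W_congr a (Relator.zigzagUp₁ (leftWeight b μ) i).twoMor_eq (x := x) (y := x)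
    h₁ h₁
  rw [W_comp μ a b _ _ _ _ h₂, W_lay, W_lay, W_id] at this
  simpa only [List.append_nil, List.nil_append, List.cons_append] using this

theorem W_zigzagUp₂ (i : ZMod n) {a' b' : Word n}
    {h₁ : x = a' ++ ([] ++ b)} {h₂ : y = a' ++ ([down i, up i] ++ b)}
    {h₃ : y = a ++ ([up i, down i] ++ b')} {h₄ : x = a ++ ([] ++ b')}
    (ha : a' = a ++ [up i] := by first | (simp; done) | simp [*])
    (hb : b' = up i :: b := by first | (simp; done) | simp [*]) :
    W μ x y a' (gn (cupR i)) b h₁ h₂ ≫ W μ y x a (gn (capR i)) b' h₃ h₄ = 𝟙 _ := by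
  subst ha hb
  have := W_congr a (Relator.zigzagUp₂ (leftWeight b μ) i).twoMor_eq (x := x) (y := x)
    h₄ h₄
  rw [W_comp μ a b _ _ _ _ h₃, W_lay, W_lay, W_id] at this
  simpa only [List.append_nil, List.nil_append, List.cons_append] using this

end

theorem W_sub (μ : Weight n) (a b : Word n) {u v x y : Word n} (f g : ob u ⟶ ob v)
    (hx : x = a ++ (u ++ b)) (hy : y = a ++ (v ++ b)) :
    W μ x y a (f - g) b hx hy = W μ x y a f b hx hy - W μ x y a g b hx hy := by
  rw [W, wh_sub, twoMor_sub]; rfl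

theorem W_neg (μ : Weight n) (a b : Word n) {u v x y : Word n} (f : ob u ⟶ ob v)
    (hx : x = a ++ (u ++ b)) (hy : y = a ++ (v ++ b)) :
    W μ x y a (-f) b hx hy = -W μ x y a f b hx hy := by
  rw [W, wh_neg, twoMor_neg]; rfl

theorem W_sum (μ : Weight n) (a b : Word n) {u v x y : Word n} {ι : Type*} (s : Finset ι)
    (f : ι → (ob u ⟶ ob v)) (hx : x = a ++ (u ++ b)) (hy : y = a ++ (v ++ b)) :
    W μ x y a (∑ k ∈ s, f k) b hx hy = ∑ k ∈ s, W μ x y a (f k) b hx hy := by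
  rw [W, wh_sum, twoMor_sum]; rfl

/-! ### Bubbles next to a strand -/

/-- `k` dots on a single upward `i`-strand. -/
def strandDots (i : ZMod n) (k : ℕ) : ob [up i] ⟶ ob [up i] := dots [] i k []

theorem strandDots_zero (i : ZMod n) : strandDots i 0 = 𝟙 _ := rfl

theorem strandDots_succ (i : ZMod n) (k : ℕ) :
    strandDots i (k + 1) = gn (dotUp i) ≫ strandDots i k :=
  pow_succ (show End (ob [up i]) from sl [] (dotUp i) []) k

theorem dots_eq_wh (a b : Word n) (i : ZMod n) (k : ℕ) :
    dots a i k b = wh a b (strandDots i k) rfl rfl := by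
  induction k with
  | zero => exact (wh_id a b rfl rfl).symm
  | succ k ih =>
    rw [strandDots_succ, wh_comp a b _ _ rfl rfl rfl, ← ih, ← lay_eq_wh]
    exact pow_succ (show End (ob (a ++ ([up i] ++ b))) from sl a (dotUp i) b) k

section

variable (μ : Weight n) (a b : Word n) (c : ZMod n) (k : ℕ) {x y : Word n}

theorem W_ccwBubble {d : Word n} (hx : x = a ++ ([] ++ b)) (hy : y = a ++ down c :: up c :: b)
    (hd : d = a ++ [down c]) :
    W μ x x a (ccwBubble c k) b hx hx =
      W μ x y a (gn (cupR c)) b ≫ W μ y y d (strandDots c k) b ≫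
        W μ y x a (gn (capL c)) b := by
  subst hx hy hd
  rw [ccwBubble, W_comp (y := a ++ down c :: up c :: b) (hy := rfl),
    W_comp (y := a ++ down c :: up c :: b) (hy := rfl), dots_eq_wh, W_wh, W_lay, W_lay]
  simp

theorem W_cwBubble (hx : x = a ++ ([] ++ b)) (hy : y = a ++ up c :: down c :: b) :
    W μ x x a (cwBubble c k) b hx hx =
      W μ x y a (gn (cupL c)) b ≫ W μ y y a (strandDots c k) (down c :: b) ≫
        W μ y x a (gn (capR c)) b := by
  subst hx hy
  rw [cwBubble, W_comp (y := a ++ up c :: down c :: b) (hy := rfl),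
    W_comp (y := a ++ up c :: down c :: b) (hy := rfl), dots_eq_wh, W_wh, W_lay, W_lay]
  simp

theorem W_ccwBubble_zero (hx : x = a ++ ([] ++ b)) (hy : y = a ++ down c :: up c :: b) :
    W μ x x a (ccwBubble c 0) b hx hx =
      W μ x y a (gn (cupR c)) b ≫ W μ y x a (gn (capL c)) b := by
  rw [W_ccwBubble μ a b c 0 hx hy rfl, strandDots_zero, W_id, Category.id_comp]

end

/-- A counterclockwise `c`-bubble on the right of an upward `j`-strand of a different colour can be
moved to its left, at the cost of a double crossing of the `j`-strand with an arc of the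
bubble. -/
theorem W_ccwBubble_right (μ : Weight n) (j c : ZMod n) (hjc : j ≠ c) :
    W μ [up j] [up j, down c, up c] [up j] (gn (cupR c)) [] ≫
        W μ [up j, down c, up c] [up j] [up j] (gn (capL c)) [] =
      W μ [up j] [down c, up c, up j] [] (gn (cupR c)) [up j] ≫
        W μ [down c, up c, up j] [down c, up j, up c] [down c] (gn (crossUp c j)) [] ≫
        W μ [down c, up j, up c] [down c, up c, up j] [down c] (gn (crossUp j c)) [] ≫
        W μ [down c, up c, up j] [up j] [] (gn (capL c)) [up j] := by
  -- The relation for a sideways double crossing, next to an upward `c`-strand.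
  have hm : W μ [up j, down c, up c] [down c, up c, up j, down c, up c] [] (gn (cupR c))
          [up j, down c, up c] ≫
        W μ _ [down c, up j, up c, down c, up c] [down c] (gn (crossUp c j)) [down c, up c] ≫
        W μ _ [down c, up j, up c] [down c, up j] (gn (capR c)) [up c] ≫
        W μ _ [down c, up j, up c, down c, up c] [down c, up j] (gn (cupL c)) [up c] ≫
        W μ _ [down c, up c, up j, down c, up c] [down c] (gn (crossUp j c)) [down c, up c] ≫
        W μ _ [up j, down c, up c] [] (gn (capL c)) [up j, down c, up c] = 𝟙 _ := by
    have := W_congr (μ := μ) [] (b := [up c]) (Relator.mixed₁ _ j c hjc).twoMor_eq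
      (x := [up j, down c, up c]) (y := [up j, down c, up c]) rfl rfl
    rw [W_id, W_comp (y := [down c, up j, up c]) (hy := rfl), crossRight, crossLeft] at this
    repeat rw [W_comp _ _ _ _ _ _ _ rfl] at this
    simp only [W_lay, Category.assoc] at this
    exact this
  -- Below the double crossing: the cup of the bubble moves to the left of the `j`-strand.
  have h1 : W μ [up j] [up j, down c, up c] [up j] (gn (cupR c)) [] ≫
        W μ _ [down c, up c, up j, down c, up c] [] (gn (cupR c)) [up j, down c, up c] =
      W μ _ [down c, up c, up j] [] (gn (cupR c)) [up j] ≫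
        W μ _ [down c, up c, up j, down c, up c] [down c, up c, up j] (gn (cupR c)) [] :=
    (W_interchange μ _ _ [up j] _ _).symm
  have h2 : W μ [down c, up c, up j] [down c, up c, up j, down c, up c]
          [down c, up c, up j] (gn (cupR c)) [] ≫
        W μ _ [down c, up j, up c, down c, up c] [down c] (gn (crossUp c j)) [down c, up c] =
      W μ _ [down c, up j, up c] [down c] (gn (crossUp c j)) [] ≫
        W μ _ [down c, up j, up c, down c, up c] [down c, up j, up c] (gn (cupR c)) [] :=
    (W_interchange μ _ _ [] _ _).symm
  have h3 : W μ [down c, up j, up c] [down c, up j, up c, down c, up c]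
          [down c, up j, up c] (gn (cupR c)) [] ≫
      W μ _ [down c, up j, up c] [down c, up j] (gn (capR c)) [up c] = 𝟙 _ :=
    W_zigzagUp₂ μ _ _ c
  -- Above it: the same for the cap of the bubble.
  have h4 : W μ [down c, up c, up j, down c, up c] [up j, down c, up c]
          [] (gn (capL c)) [up j, down c, up c] ≫
        W μ _ [up j] [up j] (gn (capL c)) [] =
      W μ _ [down c, up c, up j] [down c, up c, up j] (gn (capL c)) [] ≫
        W μ _ [up j] [] (gn (capL c)) [up j] :=
    W_interchange μ _ _ [up j] _ _
  have h5 : W μ [down c, up j, up c, down c, up c] [down c, up c, up j, down c, up c]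
          [down c] (gn (crossUp j c)) [down c, up c] ≫
        W μ _ [down c, up c, up j] [down c, up c, up j] (gn (capL c)) [] =
      W μ _ [down c, up j, up c] [down c, up j, up c] (gn (capL c)) [] ≫
        W μ _ [down c, up c, up j] [down c] (gn (crossUp j c)) [] :=
    W_interchange μ _ _ [] _ _
  have h6 : W μ [down c, up j, up c] [down c, up j, up c, down c, up c]
          [down c, up j] (gn (cupL c)) [up c] ≫
      W μ _ [down c, up j, up c] [down c, up j, up c] (gn (capL c)) [] = 𝟙 _ :=
    W_zigzagUp₁ μ _ _ c
  rw [← Category.id_comp (W μ [up j, down c, up c] [up j] [up j] (gn (capL c)) []), ← hm]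
  simp only [Category.assoc]
  rw [h4, reassoc_of% h5, reassoc_of% h6, reassoc_of% h1, reassoc_of% h2, reassoc_of% h3]

/-- For strands whose colours are not adjacent the bubble moves to the other side. -/
theorem W_ccwBubble_slide_far (μ : Weight n) (j c : ZMod n) (h₀ : j ≠ c) (h₁ : j ≠ c + 1)
    (h₂ : c ≠ j + 1) :
    W μ [up j] [up j] [up j] (ccwBubble c 0) [] = W μ [up j] [up j] [] (ccwBubble c 0) [up j] := by
  have hX : W μ [down c, up c, up j] [down c, up j, up c] [down c] (gn (crossUp c j)) [] ≫
      W μ _ [down c, up c, up j] [down c] (gn (crossUp j c)) [] = 𝟙 _ := by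
    have := W_congr (μ := μ) [down c] (b := []) (Relator.crossSqFar μ c j h₀.symm h₁ h₂).twoMor_eq
      (x := [down c, up c, up j]) (y := [down c, up c, up j]) rfl rfl
    rw [W_id, W_comp _ _ _ _ _ _ _ rfl, W_lay, W_lay] at this
    exact this
  have h := W_ccwBubble_right μ j c h₀
  rw [reassoc_of% hX] at h
  rw [W_ccwBubble_zero μ [up j] [] c (x := [up j]) rfl rfl,
    W_ccwBubble_zero μ [] [up j] c (x := [up j]) rfl rfl]
  exact h

/-! ### A bubble next to two strands of adjacent colours -/

/-- If `ν_c = 1` and `ν_{c+1} = 0`, the identity of `E_c E_{-c}` factors through the identity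
1-morphism, because `E_{-c} E_c` vanishes. -/
theorem W_capR_cupL (ν : Weight n) (c : ZMod n) (h₁ : ν c = 1) (h₀ : ν (c + 1) = 0)
    (hc : c ≠ c + 1) :
    W ν [up c, down c] [] [] (gn (capR c)) [] ≫ W ν [] [up c, down c] [] (gn (cupL c)) [] =
      𝟙 _ := by
  have hbar : bar ν c = 1 := by simp [bar, h₁, h₀]
  have hforb : ¬ Admissible [down c, up c] ν := by
    rintro ⟨⟨-, ⟨h, -⟩, -⟩, -⟩
    have := h (c + 1)
    simp [leftWeight, Strand.act, root, h₀, hc.symm] at this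
  have h := (Relator.decompUpDown ν c).twoMor_eq
  have hz : twoMor ν (crossRight c c) = 0 := by
    have := (Relator.forbidden ν _ hforb).twoMor_eq
    rw [← Category.comp_id (crossRight c c), twoMor_comp, this, twoMor_zero, Limits.comp_zero]
  have hccw : ccw ν c 0 = (-1 : ℚ) • 𝟙 _ := by
    rw [ccw, if_neg (by simp [hbar]), if_pos rfl, h₀]
    norm_num
  rw [twoMor_sub, twoMor_comp, hz, Limits.zero_comp, zero_sub, hbar] at h
  simp only [Int.toNat_one, Finset.range_one, Finset.sum_singleton, zero_add, hccw, dots, pow_zero,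
    Nat.sub_self, End.one_def] at h
  rw [twoMor_id] at h
  have hk : twoMor ν (x := [up c, down c]) (y := [up c, down c])
      (𝟙 (ob [up c, down c]) ≫ lay [] (capR c) [] (y := []) rfl rfl ≫ ((-1 : ℚ) • 𝟙 (ob [])) ≫
        lay [] (cupL c) [] (y := [up c, down c]) rfl rfl ≫ 𝟙 (ob [up c, down c])) =
      -(W ν [up c, down c] [] [] (gn (capR c)) [] ≫ W ν [] [up c, down c] [] (gn (cupL c)) []) := by
    simp only [twoMor_comp, twoMor_lay, twoMor_neg, neg_smul, one_smul,
      Preadditive.comp_neg, Preadditive.neg_comp, Category.id_comp, Category.comp_id]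
  exact ((h.trans (congrArg Neg.neg hk)).trans (neg_neg _)).symm

/-- A bubble of colour `c = j + 1` on the right of strands of colours `c, j` becomes a difference of
dots, if the weight of the region on the left of the strands is `1` at `c` and `0` at `c + 1`. -/
theorem W_ccwBubble_pair (κ : Weight n) (j : ZMod n) (hj : j ≠ j + 1) (hj' : j + 1 ≠ j + 1 + 1)
    (h₁ : leftWeight [up (j + 1), up j] κ (j + 1) = 1)
    (h₀ : leftWeight [up (j + 1), up j] κ (j + 1 + 1) = 0) :
    W κ [up (j + 1), up j] [up (j + 1), up j] [up (j + 1), up j] (ccwBubble (j + 1) 0) [] =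
      W κ [up (j + 1), up j] [up (j + 1), up j] [] (gn (dotUp (j + 1))) [up j] -
        W κ [up (j + 1), up j] [up (j + 1), up j] [up (j + 1)] (gn (dotUp j)) [] := by
  have hsq := (Relator.crossSqPred κ j).twoMor_eq
  generalize j + 1 = c at *
  -- The bubble moves between the two strands and crosses the `j`-strand twice.
  have hb : W κ [up c, up j] [up c, up j, down c, up c] [up c, up j] (gn (cupR c)) [] ≫
        W κ [up c, up j, down c, up c] [up c, up j] [up c, up j] (gn (capL c)) [] =
      W κ [up c, up j] [up c, down c, up c, up j] [up c] (gn (cupR c)) [up j] ≫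
        W κ _ [up c, down c, up j, up c] [up c, down c] (gn (crossUp c j)) [] ≫
        W κ _ [up c, down c, up c, up j] [up c, down c] (gn (crossUp j c)) [] ≫
        W κ _ [up c, up j] [up c] (gn (capL c)) [up j] := by
    have h := W_ccwBubble_right κ j c hj
    simp only [W, ← twoMor_comp] at h
    have := W_congr [up c] (b := []) h (x := [up c, up j]) (y := [up c, up j]) rfl rfl
    repeat rw [W_comp _ _ _ _ _ _ _ rfl] at this
    simp only [W_wh] at this
    exact this
  -- The `c`-strand and the adjacent arc of the bubble are cut and reconnected.
  have hi : W κ [up c, down c, up c, up j] [up c, up j] [] (gn (capR c)) [up c, up j] ≫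
      W κ [up c, up j] [up c, down c, up c, up j] [] (gn (cupL c)) [up c, up j] = 𝟙 _ := by
    have h := W_capR_cupL _ c h₁ h₀ hj'
    simp only [W, ← twoMor_comp, ← twoMor_id] at h
    have := W_congr [] h (x := [up c, down c, up c, up j]) (y := [up c, down c, up c, up j])
      rfl rfl
    rw [W_id, W_comp _ _ _ _ _ _ _ rfl] at this
    simp only [W_wh] at this
    exact this
  have h1 : W κ [up c, up j] [up c, down c, up c, up j] [up c] (gn (cupR c)) [up j] ≫
      W κ _ [up c, up j] [] (gn (capR c)) [up c, up j] = 𝟙 _ :=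
    W_zigzagUp₂ κ _ _ c
  have h2 : W κ [up c, up j] [up c, down c, up c, up j] [] (gn (cupL c)) [up c, up j] ≫
        W κ _ [up c, down c, up j, up c] [up c, down c] (gn (crossUp c j)) [] =
      W κ _ [up j, up c] [] (gn (crossUp c j)) [] ≫
        W κ _ [up c, down c, up j, up c] [] (gn (cupL c)) [up j, up c] :=
    W_interchange κ _ _ [] _ _
  have h3 : W κ [up j, up c] [up c, down c, up j, up c] [] (gn (cupL c)) [up j, up c] ≫
        W κ _ [up c, down c, up c, up j] [up c, down c] (gn (crossUp j c)) [] =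
      W κ _ [up c, up j] [] (gn (crossUp j c)) [] ≫
        W κ _ [up c, down c, up c, up j] [] (gn (cupL c)) [up c, up j] :=
    W_interchange κ _ _ [] _ _
  have h4 : W κ [up c, up j] [up c, down c, up c, up j] [] (gn (cupL c)) [up c, up j] ≫
      W κ _ [up c, up j] [up c] (gn (capL c)) [up j] = 𝟙 _ :=
    W_zigzagUp₁ κ _ _ c
  -- What remains is a double crossing of strands of adjacent colours.
  have h5 : W κ [up c, up j] [up j, up c] [] (gn (crossUp c j)) [] ≫
      W κ _ [up c, up j] [] (gn (crossUp j c)) [] =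
      W κ [up c, up j] [up c, up j] [] (gn (dotUp c)) [up j] -
        W κ [up c, up j] [up c, up j] [up c] (gn (dotUp j)) [] := by
    rw [twoMor_comp, diff, twoMor_sub] at hsq
    simp only [twoMor_lay] at hsq
    exact hsq
  rw [W_ccwBubble_zero κ [up c, up j] [] c (x := [up c, up j]) rfl rfl]
  refine hb.trans ?_
  rw [← h5, ← Category.id_comp (W κ [up c, down c, up c, up j] [up c, down c, up j, up c]
    [up c, down c] (gn (crossUp c j)) []), ← hi]
  simp only [Category.assoc]
  rw [reassoc_of% h1, reassoc_of% h2, reassoc_of% h3, h4, Category.comp_id]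

/-! ### Splitting the delta-strand next to a bubble -/

theorem ups_append (L M : List (ZMod n)) : ups (L ++ M) = ups L ++ ups M := List.map_append

theorem ups_cons (i : ZMod n) (L : List (ZMod n)) : ups (i :: L) = up i :: ups L := rfl

theorem ups_nil : ups ([] : List (ZMod n)) = [] := rfl

/-- A bubble on the right of the delta-strand is absorbed by the splitter whose last strand has the
colour of the bubble.  The splitters and the cap and cup between them are inserted next to the
downward arc of the bubble. -/
theorem W_ccwBubble_delta (μ : Weight n) {i j : ZMod n} (hij : i = j - 1) {L : List (ZMod n)}
    (h : colors i = L ++ [j]) (k : ℕ) {x : Word n} (hx : x = ups L ++ [up j])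
    (hx' : x = ups (colors i)) :
    W μ [dup] [dup] [dup] (ccwBubble j k) [] =
      W μ [dup] x [] (gn (splitUp i)) [] ≫ W μ x x (ups L) (strandDots j k) [] ≫
        W μ x [dup] [] (gn (mergeUp i)) [] := by
  obtain ⟨y, hy⟩ : ∃ y, y = ups L ++ [up j, down j, up j] := ⟨_, rfl⟩
  have hc : ups (colors i) = ups L ++ [up j] := by rw [h, ups_append]; rfl
  have hy' : y = ups (colors i) ++ [down j, up j] := by rw [hy, hc]; simp
  -- The identity of `E_δ E_{-j}`, with the other arc of the bubble on its right.
  have hd : W μ [dup, down j, up j] y [] (gn (splitUp i)) [down j, up j] ≫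
      W μ y x (ups L) (gn (capR j)) [up j] ≫ W μ x y (ups L) (gn (cupL j)) [up j] ≫
      W μ y [dup, down j, up j] [] (gn (mergeUp i)) [down j, up j] = 𝟙 _ := by
    subst hij
    have hr : twoMor (leftWeight [up j] μ)
        (lay [] (splitUp (j - 1)) [down j] (x := [dup, down j]) (y := ups L ++ [up j, down j]) rfl
            (by simp [hc]) ≫
          lay (ups L) (capR j) [] (y := ups L) rfl (List.append_nil _).symm ≫
          lay (ups L) (cupL j) [] (y := ups L ++ [up j, down j]) (List.append_nil _).symm rfl ≫
          lay [] (mergeUp (j - 1)) [down j] (y := [dup, down j]) (by simp [hc]) rfl) =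
        twoMor _ (𝟙 _) := (Relator.deltaDown _ j L h).twoMor_eq
    have := W_congr (μ := μ) [] (b := [up j]) hr
      (x := [dup, down j, up j]) (y := [dup, down j, up j]) rfl rfl
    rw [W_id, W_comp (y := y) (hy := by simp [hy]), W_comp (y := x) (hy := by simp [hx]),
      W_comp (y := y) (hy := by simp [hy])] at this
    rw [W_lay, W_lay, W_lay, W_lay] at this
    exact this
  clear hij h
  have h1 : W μ [dup] [dup, down j, up j] [dup] (gn (cupR j)) [] ≫
        W μ [dup, down j, up j] y [] (gn (splitUp i)) [down j, up j] =
      W μ [dup] x [] (gn (splitUp i)) [] ≫ W μ x y x (gn (cupR j)) [] :=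
    (W_interchange μ _ _ [] _ _).symm
  have h2 : W μ x y x (gn (cupR j)) [] ≫ W μ y x (ups L) (gn (capR j)) [up j] = 𝟙 _ :=
    W_zigzagUp₂ μ _ _ j
  have h3 : W μ y [dup, down j, up j] [] (gn (mergeUp i)) [down j, up j] ≫
        W μ [dup, down j, up j] [dup, down j, up j] [dup, down j] (strandDots j k) [] =
      W μ y y (ups L ++ [up j, down j]) (strandDots j k) [] ≫
        W μ y [dup, down j, up j] [] (gn (mergeUp i)) [down j, up j] :=
    W_interchange μ _ _ [down j] _ _
  have h4 : W μ y [dup, down j, up j] [] (gn (mergeUp i)) [down j, up j] ≫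
        W μ [dup, down j, up j] [dup] [dup] (gn (capL j)) [] =
      W μ y x x (gn (capL j)) [] ≫ W μ x [dup] [] (gn (mergeUp i)) [] :=
    W_interchange μ _ _ [] _ _
  have h5 : W μ x y (ups L) (gn (cupL j)) [up j] ≫
        W μ y y (ups L ++ [up j, down j]) (strandDots j k) [] =
      W μ x x (ups L) (strandDots j k) [] ≫ W μ x y (ups L) (gn (cupL j)) [up j] :=
    W_interchange μ _ _ [] _ _
  have h6 : W μ x y (ups L) (gn (cupL j)) [up j] ≫ W μ y x x (gn (capL j)) [] = 𝟙 _ :=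
    W_zigzagUp₁ μ _ _ j
  have hb := W_ccwBubble μ [dup] [] j k (d := [dup, down j]) (x := [dup])
    (y := [dup, down j, up j]) rfl rfl rfl
  rw [← Category.id_comp (W μ _ _ _ (strandDots j k) _ _ _), ← hd] at hb
  simp only [Category.assoc] at hb
  rw [reassoc_of% h1, reassoc_of% h2, reassoc_of% h3, h4, reassoc_of% h5, reassoc_of% h6] at hb
  exact hb

/-- The mirror image of `W_ccwBubble_delta`: the colour of the bubble is that of the first strand of
the splitter. -/
theorem W_cwBubble_delta (μ : Weight n) (i : ZMod n) {L : List (ZMod n)}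
    (h : colors i = i :: L) (k : ℕ) {x : Word n} (hx : x = up i :: ups L)
    (hx' : x = ups (colors i)) :
    W μ [dup] [dup] [] (cwBubble i k) [dup] =
      W μ [dup] x [] (gn (splitUp i)) [] ≫ W μ x x [] (strandDots i k) (ups L) ≫
        W μ x [dup] [] (gn (mergeUp i)) [] := by
  obtain ⟨y, hy⟩ : ∃ y, y = up i :: down i :: up i :: ups L := ⟨_, rfl⟩
  have hc : ups (colors i) = up i :: ups L := by rw [h]; rfl
  have hy' : y = up i :: down i :: ups (colors i) := by rw [hy, hc]
  -- The identity of `E_{-i} E_δ`, with the other arc of the bubble on its left.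
  have hd : W μ [up i, down i, dup] y [up i, down i] (gn (splitUp i)) [] ≫
      W μ y x [up i] (gn (capL i)) (ups L) ≫ W μ x y [up i] (gn (cupR i)) (ups L) ≫
      W μ y [up i, down i, dup] [up i, down i] (gn (mergeUp i)) [] = 𝟙 _ := by
    have hr : twoMor μ
        (lay [down i] (splitUp i) [] (x := [down i, dup]) (y := down i :: up i :: ups L) rfl
            (by simp [hc]) ≫
          lay [] (capL i) (ups L) (y := ups L) rfl rfl ≫
          lay [] (cupR i) (ups L) (y := down i :: up i :: ups L) rfl rfl ≫
          lay [down i] (mergeUp i) [] (y := [down i, dup]) (by simp [hc]) rfl) =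
        twoMor _ (𝟙 _) := (Relator.downDelta _ i L h).twoMor_eq
    have := W_congr (μ := μ) [up i] (b := []) hr
      (x := [up i, down i, dup]) (y := [up i, down i, dup]) rfl rfl
    rw [W_id, W_comp (y := y) (hy := by simp [hy]), W_comp (y := x) (hy := by simp [hx]),
      W_comp (y := y) (hy := by simp [hy])] at this
    rw [W_lay, W_lay, W_lay, W_lay] at this
    simp only [List.append_nil] at this
    exact this
  clear h
  have h1 : W μ [dup] [up i, down i, dup] [] (gn (cupL i)) [dup] ≫
        W μ [up i, down i, dup] y [up i, down i] (gn (splitUp i)) [] =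
      W μ [dup] x [] (gn (splitUp i)) [] ≫ W μ x y [] (gn (cupL i)) x :=
    W_interchange μ _ _ [] _ _
  have h2 : W μ x y [] (gn (cupL i)) x ≫ W μ y x [up i] (gn (capL i)) (ups L) = 𝟙 _ :=
    W_zigzagUp₁ μ _ _ i
  have h3 : W μ y [up i, down i, dup] [up i, down i] (gn (mergeUp i)) [] ≫
        W μ [up i, down i, dup] [up i, down i, dup] [] (strandDots i k) [down i, dup] =
      W μ y y [] (strandDots i k) (down i :: up i :: ups L) ≫
        W μ y [up i, down i, dup] [up i, down i] (gn (mergeUp i)) [] :=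
    (W_interchange μ _ _ [down i] _ _).symm
  have h4 : W μ y [up i, down i, dup] [up i, down i] (gn (mergeUp i)) [] ≫
        W μ [up i, down i, dup] [dup] [] (gn (capR i)) [dup] =
      W μ y x [] (gn (capR i)) x ≫ W μ x [dup] [] (gn (mergeUp i)) [] :=
    (W_interchange μ _ _ [] _ _).symm
  have h5 : W μ x y [up i] (gn (cupR i)) (ups L) ≫
        W μ y y [] (strandDots i k) (down i :: up i :: ups L) =
      W μ x x [] (strandDots i k) (ups L) ≫ W μ x y [up i] (gn (cupR i)) (ups L) :=
    (W_interchange μ _ _ [] _ _).symm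
  have h6 : W μ x y [up i] (gn (cupR i)) (ups L) ≫ W μ y x [] (gn (capR i)) x = 𝟙 _ :=
    W_zigzagUp₂ μ _ _ i
  have hb := W_cwBubble μ [] [dup] i k (x := [dup]) (y := [up i, down i, dup]) rfl rfl
  rw [← Category.id_comp (W μ _ _ _ (strandDots i k) _ _ _), ← hd] at hb
  simp only [Category.assoc] at hb
  rw [reassoc_of% h1, reassoc_of% h2, reassoc_of% h3, h4, reassoc_of% h5, reassoc_of% h6] at hb
  exact hb

/-! ### Dots on the strands of a split delta-strand -/

theorem natCast_ne_zero {k : ℕ} (h₀ : 0 < k) (h : k < n) : (k : ZMod n) ≠ 0 := by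
  rw [Ne, ZMod.natCast_eq_zero_iff]
  exact Nat.not_dvd_of_pos_of_lt h₀ h

theorem length_descending (i : ZMod n) (k : ℕ) : (descending i k).length = k := by
  induction k generalizing i with
  | zero => rfl
  | succ k ih => simp [descending, ih]

theorem descending_add (i : ZMod n) (p q : ℕ) :
    descending i (p + q) = descending i p ++ descending (i - (p : ZMod n)) q := by
  induction p generalizing i with
  | zero => simp [descending]
  | succ p ih =>
    rw [show p + 1 + q = p + q + 1 by omega]
    simp only [descending, ih, List.cons_append]
    congr 3
    push_cast
    ring

theorem mem_descending {i l : ZMod n} {k : ℕ} (h : l ∈ descending i k) :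
    ∃ r < k, l = i - (r : ℕ) := by
  induction k generalizing i with
  | zero => simp [descending] at h
  | succ k ih =>
    rcases List.mem_cons.1 h with rfl | h
    · exact ⟨0, k.succ_pos, by simp⟩
    · obtain ⟨r, hr, rfl⟩ := ih h
      exact ⟨r + 1, by omega, by push_cast; ring⟩

theorem colors_eq_cons (hn : 0 < n) (i : ZMod n) :
    colors i = i :: descending (i - 1) (n - 1) := by
  obtain ⟨m, rfl⟩ := Nat.exists_eq_succ_of_ne_zero hn.ne'
  rfl

theorem colors_eq_concat (hn : 0 < n) (i : ZMod n) :
    colors i = descending i (n - 1) ++ [i + 1] := by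
  have h : descending i n = descending i (n - 1 + 1) := by
    congr
    omega
  have h' : i - ((n - 1 : ℕ) : ZMod n) = i + 1 := by
    rw [Nat.cast_sub hn]
    simp
  conv_lhs => rw [colors, h, descending_add, h']
  rfl

/-- The root of the strands `c, c-1, ..., c-q+1` is `ε_{c-q+1} - ε_{c+1}`, by telescoping. -/
theorem leftWeight_descending (c : ZMod n) (q : ℕ) :
    leftWeight (ups (descending c q)) (ones n) =
      ones n + Pi.single (c - q + 1) 1 - Pi.single (c + 1) 1 := by
  induction q generalizing c with
  | zero => simp [descending, ups, leftWeight]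
  | succ q ih =>
    simp only [descending, ups_cons, leftWeight, ih, Strand.act, root]
    have : c - 1 - (q : ZMod n) + 1 = c - ((q + 1 : ℕ) : ZMod n) + 1 := by push_cast; ring
    rw [this, sub_add_cancel]
    abel

/-- The endomorphism given by a diagram `f` with equal bottom and top, with identity strands `a`
on its left and `b` on its right. -/
def WEnd (μ : Weight n) (x a : Word n) {u : Word n} (f : End (ob u)) (b : Word n)
    (hx : x = a ++ (u ++ b)) : End (oneMor μ x) :=
  W μ x x a f b hx hx

theorem WEnd_pow (μ : Weight n) (a b : Word n) {u x : Word n} (f : End (ob u)) (k : ℕ)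
    (hx : x = a ++ (u ++ b)) : WEnd μ x a (f ^ k) b hx = WEnd μ x a f b hx ^ k := by
  induction k with
  | zero => exact W_id μ a b hx hx
  | succ k ih =>
    rw [pow_succ, pow_succ, End.mul_def, End.mul_def, WEnd, W_comp μ a b _ _ hx hx hx]
    exact congrArg (W μ x x a f b hx hx ≫ ·) ih

theorem W_strandDots (μ : Weight n) (a b : Word n) (i : ZMod n) (k : ℕ) {x : Word n}
    (hx : x = a ++ ([up i] ++ b)) :
    W μ x x a (strandDots i k) b hx hx = WEnd μ x a (gn (dotUp i)) b hx ^ k :=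
  WEnd_pow μ a b (u := [up i]) (gn (dotUp i)) k hx

theorem ups_eq_take_append_drop (L : List (ZMod n)) (p : ℕ) (h : p < L.length) :
    ups L = ups (L.take p) ++ ([up L[p]] ++ ups (L.drop (p + 1))) := by
  conv_lhs => rw [← List.take_append_drop p L, ← List.cons_getElem_drop_succ (h := h), ups_append]
  rfl

/-- A dot on the upward strand in position `p` (counted from the left, starting with `0`) of
a word of upward strands; it is zero if there is no such strand. -/
def dotAt (μ : Weight n) (L : List (ZMod n)) (p : ℕ) : End (oneMor μ (ups L)) :=
  if h : p < L.length then
    W μ (ups L) (ups L) (ups (L.take p)) (gn (dotUp L[p])) (ups (L.drop (p + 1)))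
      (ups_eq_take_append_drop L p h) (ups_eq_take_append_drop L p h)
  else 0

theorem WEnd_dot_congr (μ : Weight n) {x a a' b b' : Word n} {j j' : ZMod n} (ha : a = a')
    (hb : b = b') (hj : j = j') (hx : x = a ++ ([up j] ++ b)) (hx' : x = a' ++ ([up j'] ++ b')) :
    WEnd μ x a (gn (dotUp j)) b hx = WEnd μ x a' (gn (dotUp j')) b' hx' := by
  subst ha hb hj
  rfl

theorem dotAt_eq (μ : Weight n) {L M N : List (ZMod n)} {j : ZMod n} {p : ℕ}
    (h : L = M ++ j :: N) (hp : M.length = p) {a b : Word n} (ha : a = ups M) (hb : b = ups N)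
    (hx : ups L = a ++ ([up j] ++ b)) :
    WEnd μ (ups L) a (gn (dotUp j)) b hx = dotAt μ L p := by
  subst h hp
  rw [dotAt, dif_pos (by simp)]
  exact WEnd_dot_congr μ (by simp [ha]) (by simp [hb]) (by simp) _ _

/-! ### Bubbles as dots between a splitter and a merger -/

/-- The splitter `E_δ → E_i E_{i-1} ⋯ E_{i+1}` as a 2-morphism. -/
def split (μ : Weight n) (i : ZMod n) : oneMor μ [dup] ⟶ oneMor μ (ups (colors i)) :=
  W μ [dup] (ups (colors i)) [] (gn (splitUp i)) []

/-- The splitter `E_i E_{i-1} ⋯ E_{i+1} → E_δ` as a 2-morphism. -/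
def merge (μ : Weight n) (i : ZMod n) : oneMor μ (ups (colors i)) ⟶ oneMor μ [dup] :=
  W μ (ups (colors i)) [dup] [] (gn (mergeUp i)) []

/-- A closed diagram to the left of the delta-strand. -/
def leftOf (μ : Weight n) (f : End (ob ([] : Word n))) : End (oneMor μ [dup]) :=
  WEnd μ [dup] [] f [dup] rfl

/-- A closed diagram to the right of the delta-strand. -/
def rightOf (μ : Weight n) (f : End (ob ([] : Word n))) : End (oneMor μ [dup]) :=
  WEnd μ [dup] [dup] f [] rfl

theorem rightOf_ccwBubble (hn : 0 < n) (μ : Weight n) (i : ZMod n) (k : ℕ) :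
    rightOf μ (ccwBubble (i + 1) k) =
      split μ i ≫ (dotAt μ (colors i) (n - 1) ^ k : End (oneMor μ (ups (colors i)))) ≫
        merge μ i := by
  have hL := colors_eq_concat hn i
  have hx : ups (colors i) = ups (descending i (n - 1)) ++ [up (i + 1)] := by
    rw [hL, ups_append]; rfl
  rw [← dotAt_eq μ hL (length_descending _ _) rfl ups_nil.symm hx, ← W_strandDots]
  exact W_ccwBubble_delta μ (eq_sub_of_add_eq rfl) hL k hx rfl

theorem leftOf_cwBubble (hn : 0 < n) (μ : Weight n) (i : ZMod n) (k : ℕ) :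
    leftOf μ (cwBubble i k) =
      split μ i ≫ (dotAt μ (colors i) 0 ^ k : End (oneMor μ (ups (colors i)))) ≫
        merge μ i := by
  have hL := colors_eq_cons hn i
  have hx : ups (colors i) = up i :: ups (descending (i - 1) (n - 1)) := by
    rw [hL]; rfl
  rw [← dotAt_eq μ (M := []) (p := 0) hL rfl ups_nil.symm rfl hx, ← W_strandDots]
  exact W_cwBubble_delta μ i hL k hx rfl

theorem colors_eq_cons_concat (hn : 2 ≤ n) (i : ZMod n) :
    colors i = i :: (descending (i - 1) (n - 2) ++ [i + 1]) := by
  rw [colors_eq_concat (by omega) i, show n - 1 = n - 2 + 1 by omega]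
  rfl

theorem dotAt_comm (hn : 2 ≤ n) (i : ZMod n) (μ : Weight n) :
    dotAt μ (colors i) (n - 1) * dotAt μ (colors i) 0 =
      dotAt μ (colors i) 0 * dotAt μ (colors i) (n - 1) := by
  have hL := colors_eq_cons_concat hn i
  have hx : ups (colors i) =
      up i :: (ups (descending (i - 1) (n - 2)) ++ [up (i + 1)]) := by
    conv_lhs => rw [hL, ups_cons, ups_append]
    rfl
  have hx' : ups (colors i) =
      (up i :: ups (descending (i - 1) (n - 2))) ++ [up (i + 1)] := by
    rw [hx]; rfl
  rw [← dotAt_eq μ (M := []) (p := 0) hL rfl ups_nil.symm rfl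
      (by rw [ups_append]; exact hx),
    ← dotAt_eq μ (M := i :: descending (i - 1) (n - 2)) (N := []) (p := n - 1) hL
      (by rw [List.length_cons, length_descending]; omega) rfl ups_nil.symm (by exact hx')]
  refine W_interchange μ [] [] (ups (descending (i - 1) (n - 2))) (gn (dotUp i))
    (gn (dotUp (i + 1))) ?_ ?_ ?_ ?_
  · rw [ups_append]; rfl
  · simp [ups]
  · rw [ups_append]; rfl
  · simp [ups]

/-- The infinite Grassmannian relation of degree two in the region `(1^n)`, where the bubbles of
degree zero are `-1` and `1`. -/
theorem cwBubble_eq_ccwBubble (c : ZMod n) :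
    twoMor (ones n) (cwBubble c 0) = twoMor (ones n) (ccwBubble c 0) := by
  have h := (Relator.grassmannian (ones n) c 1 one_pos).twoMor_eq
  have hb : bar (ones n) c = 0 := by simp [bar, ones]
  have h1 : cw (ones n) c 0 = (-1 : ℚ) • 𝟙 _ := by
    rw [cw, if_neg (by simp [hb]), if_pos rfl]
    simp [ones]
  have h2 : ccw (ones n) c 0 = 𝟙 _ := by
    rw [ccw, if_neg (by simp [hb]), if_pos rfl]
    simp [ones]
  have h3 : cw (ones n) c 1 = cwBubble c 0 := by
    rw [cw, if_pos (by simp [hb])]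
    simp [hb]
  have h4 : ccw (ones n) c 1 = ccwBubble c 0 := by
    rw [ccw, if_pos (by simp [hb])]
    simp [hb]
  rw [Finset.sum_range_succ, Finset.sum_range_one] at h
  simp only [Nat.sub_zero, Nat.sub_self, h1, h2, h3, h4, twoMor_add, Category.id_comp,
    twoMor_zero, neg_smul, one_smul] at h
  have hneg : twoMor (ones n) (ccwBubble c 0 ≫ (-𝟙 (ob [])) : ob [] ⟶ ob []) =
      -twoMor (ones n) (ccwBubble c 0) := by
    rw [Preadditive.comp_neg, Category.comp_id, twoMor_neg]
  exact eq_of_sub_eq_zero ((sub_eq_add_neg _ _).trans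
    ((congrArg (twoMor (ones n) (cwBubble c 0) + ·) hneg.symm).trans h))

theorem leftOf_congr {f g : End (ob ([] : Word n))}
    (h : twoMor (ones n) f = twoMor (ones n) g) : leftOf (ones n) f = leftOf (ones n) g :=
  W_congr (μ := ones n) [] (b := [dup]) h rfl rfl

theorem rightOf_congr {f g : End (ob ([] : Word n))}
    (h : twoMor (ones n) f = twoMor (ones n) g) : rightOf (ones n) f = rightOf (ones n) g :=
  W_congr (μ := ones n) [dup] (b := []) h rfl rfl

/-- A degree-two bubble changes its colour when it passes the delta-strand. -/
theorem leftOf_ccwBubble_zero (hn : 0 < n) (c : ZMod n) :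
    leftOf (ones n) (ccwBubble c 0) = rightOf (ones n) (ccwBubble (c + 1) 0) := by
  rw [← leftOf_congr (cwBubble_eq_ccwBubble c), leftOf_cwBubble hn, rightOf_ccwBubble hn,
    pow_zero, pow_zero]

/-- The binomial theorem, with one of the variables acting on the other side of `S`. -/
theorem sum_choose_comp {C : Type*} [Category C] [Preadditive C] [Linear ℚ C] {D Y : C}
    (S : D ⟶ Y) (M : Y ⟶ D) (Z : End D) (A X : End Y) (hZ : Z ≫ S = S ≫ X)
    (hAX : A * X = X * A) (s : ℕ) :
    ∑ j ∈ Finset.range (s + 1), (s.choose j : ℚ) •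
        ((Z ^ j : End D) ≫ S ≫ (A ^ (s - j) : End Y) ≫ M) =
      S ≫ ((A + X) ^ s : End Y) ≫ M := by
  have hZj : ∀ j : ℕ, (Z ^ j : End D) ≫ S = S ≫ (X ^ j : End Y) := by
    intro j
    induction j with
    | zero => exact (Category.id_comp S).trans (Category.comp_id S).symm
    | succ j ih =>
      rw [pow_succ, pow_succ, End.mul_def, End.mul_def, Category.assoc, ih, reassoc_of% hZ]
  have hcomm : Commute X A := hAX.symm
  rw [add_comm A X, hcomm.add_pow, Preadditive.sum_comp, Preadditive.comp_sum]
  refine Finset.sum_congr rfl fun j _ => ?_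
  rw [reassoc_of% (hZj j), ← nsmul_eq_mul', (hcomm.pow_pow j (s - j)).eq, End.mul_def,
    Nat.cast_smul_eq_nsmul]
  have e : ∀ (k : ℕ) (f : Y ⟶ Y), k • (S ≫ f ≫ M) = S ≫ (k • f) ≫ M := by simp
  rw [← e, Category.assoc]

/-! ### Sliding undotted bubbles through a splitter -/

/-- Each step of `blockCross` is a `passRight` across a single strand, followed by an identity. -/
theorem blockCross_singleton (c : ZMod n) (L : List (ZMod n)) (a b : Word n) {x y : Word n}
    (hx : x = a ++ (ups L ++ (ups [c] ++ b))) (hy : y = a ++ (ups [c] ++ (ups L ++ b))) :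
    blockCross L [c] a b hx hy = passLeft c L a b hx hy := by
  induction L generalizing a x y with
  | nil => rfl
  | cons j L ih =>
    subst hy
    rw [blockCross, ih]
    simp only [passRight]
    exact congrArg _ (Category.comp_id _)

theorem dotAt_zero (μ : Weight n) {K M : List (ZMod n)} {i : ZMod n} (h : K = i :: M)
    (hx : ups K = [] ++ ([up i] ++ ups M)) :
    W μ (ups K) (ups K) [] (gn (dotUp i)) (ups M) hx hx = dotAt μ K 0 :=
  dotAt_eq μ (M := []) h rfl rfl rfl hx

/-- The case of a bubble with the colour of the first strand of the splitter.  The bubble is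
`split i ≫ merge i`, and `merge i ≫ split (i + 1)` is a crossing. -/
theorem rightOf_ccwBubble_split_zero (hn : 2 ≤ n) (i : ZMod n) :
    rightOf (ones n) (ccwBubble (i + 1) 0) ≫ split (ones n) (i + 1) =
      split (ones n) (i + 1) ≫
        (dotAt (ones n) (colors (i + 1)) 0 - dotAt (ones n) (colors (i + 1)) 1) := by
  have hL := colors_eq_concat (by omega) i
  have hL' := colors_eq_cons (by omega) (i + 1)
  rw [add_sub_cancel_right] at hL'
  obtain ⟨M, hM⟩ : ∃ M, descending i (n - 1) = i :: M :=
    ⟨descending (i - 1) (n - 2), by rw [show n - 1 = n - 2 + 1 by omega]; rfl⟩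
  generalize descending i (n - 1) = L at hL hL' hM
  have hx : ups (colors i) = ups L ++ [up (i + 1)] := by rw [hL, ups_append]; rfl
  have hx' : ups (colors (i + 1)) = up (i + 1) :: ups L := by rw [hL']; rfl
  rw [rightOf_ccwBubble (by omega), pow_zero, End.one_def, Category.id_comp, Category.assoc]
  have h1 : twoMor (ones n)
      (lay [] (mergeUp i) [] (x := ups L ++ [up (i + 1)]) (y := [dup]) (by simp [hx]) rfl ≫
        lay [] (splitUp (i + 1)) [] (y := up (i + 1) :: ups L) rfl (by simp [hx'])) =
      twoMor (ones n) (passLeft (i + 1) L [] [] (by simp) (by simp)) := by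
    have := (Relator.mergeSplitDifferent i (i + 1) (by
      intro h
      have h2 := natCast_ne_zero (n := n) (k := 1) one_pos hn
      exact h2 (by simpa using h.symm)) L [i + 1] hL hL').twoMor_eq
    rw [blockCross_singleton] at this
    exact this
  have h2 : twoMor (ones n)
      (lay [] (splitUp i) [] (x := [dup]) (y := ups L ++ [up (i + 1)]) rfl (by simp [hx]) ≫
        passLeft (i + 1) L [] [] (by simp) (by simp)) =
      twoMor (ones n)
        (lay [] (splitUp (i + 1)) [] (y := up (i + 1) :: ups L) rfl (by simp [hx']) ≫
          diff (lay [] (dotUp (i + 1)) (ups L) rfl rfl)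
            (lay [up (i + 1)] (dotUp i) (ups M) (by simp [hM, ups_cons])
              (by simp [hM, ups_cons]))) :=
    (Relator.splitPassLeft (ones n) i L hL hL' M hM).twoMor_eq
  rw [twoMor_comp, ← h1, ← twoMor_comp] at h2
  have h3 := W_congr (μ := ones n) [] (b := []) h2 (x := [dup]) (y := ups (colors (i + 1)))
    rfl (by simp [hx'])
  rw [W_comp (y := ups (colors i)) (hy := by simp [hx]), W_comp (y := [dup]) (hy := rfl),
    W_comp (y := ups (colors (i + 1))) (hy := by simp [hx']), diff, W_sub] at h3
  rw [W_lay, W_lay, W_lay, W_lay, W_lay] at h3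
  simp only [List.append_nil] at h3
  rw [← dotAt_zero (ones n) hL' hx',
    ← dotAt_eq (ones n) (M := [i + 1]) (N := M) (p := 1) (a := [up (i + 1)])
      (hL'.trans (by rw [hM]; rfl)) rfl rfl rfl (by rw [hx', hM]; rfl)]
  exact h3

/-- Undotted bubbles slide past blocks of strands of distant colours. -/
theorem W_ccwBubble_slide_block (μ : Weight n) (c : ZMod n) (L : List (ZMod n))
    (hL : ∀ l ∈ L, l ≠ c ∧ l ≠ c + 1 ∧ c ≠ l + 1) (a b : Word n) {d e x : Word n}
    (hd : d = a ++ ups L) (he : e = ups L ++ b) (hx : x = d ++ ([] ++ b))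
    (hx' : x = a ++ ([] ++ e)) :
    W μ x x d (ccwBubble c 0) b hx hx = W μ x x a (ccwBubble c 0) e hx' hx' := by
  induction L generalizing a e with
  | nil =>
    obtain rfl : d = a := by simpa [ups] using hd
    obtain rfl : e = b := by simpa [ups] using he
    rfl
  | cons l L ih =>
    obtain ⟨h₀, h₁, h₂⟩ := hL l (by simp)
    have h3 := ih (fun l' hl' => hL l' (by simp [hl'])) (a ++ [up l]) (by simp [hd, ups])
      (e := ups L ++ b) rfl (by simp [hx', he, ups])
    have hp : x = a ++ ([up l] ++ (ups L ++ b)) := by simp [hx', he, ups]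
    have h4 := (W_wh μ a (ups L ++ b) (u := [up l]) (v := [up l]) (a' := [up l]) (b' := [])
      (ccwBubble c 0) rfl rfl hp hp).symm.trans
        ((W_congr a (W_ccwBubble_slide_far _ l c h₀ h₁ h₂) hp hp).trans
          (W_wh μ a (ups L ++ b) (u := [up l]) (v := [up l]) (a' := []) (b' := [up l])
            (ccwBubble c 0) rfl rfl hp hp))
    refine h3.trans (h4.trans ?_)
    subst he
    simp [ups]

/-- A bubble on the right of the word `M, c, c-1, L` with `c = j + 1`, where the colours in `L` are
distant from `c`. -/
theorem W_ccwBubble_ups (μ : Weight n) {K M L : List (ZMod n)} {j : ZMod n} {p : ℕ}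
    (hK : K = M ++ (j + 1) :: j :: L) (hp : M.length = p) (hj : j ≠ j + 1)
    (hj' : j + 1 ≠ j + 1 + 1) (hL : ∀ l ∈ L, l ≠ j + 1 ∧ l ≠ j + 1 + 1 ∧ j + 1 ≠ l + 1)
    (h₁ : leftWeight [up (j + 1), up j] (leftWeight (ups L) μ) (j + 1) = 1)
    (h₀ : leftWeight [up (j + 1), up j] (leftWeight (ups L) μ) (j + 1 + 1) = 0)
    (hx : ups K = ups K ++ ([] ++ [])) :
    W μ (ups K) (ups K) (ups K) (ccwBubble (j + 1) 0) [] hx hx =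
      dotAt μ K p - dotAt μ K (p + 1) := by
  have hK' : K = (M ++ [j + 1]) ++ j :: L := by simp [hK]
  rw [← dotAt_eq μ hK hp rfl rfl (by rw [hK]; simp [ups]),
    ← dotAt_eq μ (p := p + 1) hK' (by simp [hp]) rfl rfl (by rw [hK]; simp [ups])]
  have hy : ups K = ups M ++ ([up (j + 1), up j] ++ ups L) := by rw [hK]; simp [ups]
  have h1 := W_ccwBubble_slide_block μ (j + 1) L hL (ups M ++ [up (j + 1), up j]) []
    (d := ups K) (e := ups L) (x := ups K) (by simp [hy]) (by simp) hx (by simp [hy])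
  have h2 := W_ccwBubble_pair (leftWeight (ups L) μ) j hj hj' h₁ h₀
  rw [W, W, W, ← twoMor_sub] at h2
  have h3 := W_congr (ups M) h2 hy hy
  rw [W_sub, W_wh, W_wh, W_wh] at h3
  simp only [List.nil_append, List.append_nil] at h3
  refine h1.trans (h3.trans ?_)
  congr 1
  simp only [WEnd, ups_append]
  rfl

theorem rightOf_comp_split (μ : Weight n) (i : ZMod n) (f : End (ob ([] : Word n)))
    (hx : ups (colors i) = ups (colors i) ++ ([] ++ [])) :
    rightOf μ f ≫ split μ i =
      split μ i ≫ W μ (ups (colors i)) (ups (colors i)) (ups (colors i)) f [] hx hx :=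
  (W_interchange μ [] [] [] (gn (splitUp i)) f).symm

/-- An undotted bubble on the right of the delta-strand, of the colour of the strand in position `p`
of the splitter, is a difference of dots on the split strands. -/
theorem rightOf_ccwBubble_split (hn : 3 ≤ n) (i : ZMod n) (p : ℕ) (hp : p < n - 1) :
    rightOf (ones n) (ccwBubble (i - p) 0) ≫ split (ones n) i =
      split (ones n) i ≫ (dotAt (ones n) (colors i) p - dotAt (ones n) (colors i) (p + 1)) := by
  obtain rfl | hp₀ := p.eq_zero_or_pos
  · obtain ⟨j, rfl⟩ : ∃ j : ZMod n, i = j + 1 := ⟨i - 1, by ring⟩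
    rw [Nat.cast_zero, sub_zero]
    exact rightOf_ccwBubble_split_zero (by omega) j
  obtain ⟨j, hj⟩ : ∃ j : ZMod n, i - p = j + 1 := ⟨i - p - 1, by ring⟩
  have hK : colors i = descending i p ++ (j + 1) :: j :: descending (j - 1) (n - p - 2) := by
    have h : descending i n = descending i (p + (n - p - 2 + 1 + 1)) :=
      congrArg (descending i) (by omega)
    rw [colors, h, descending_add, hj]
    simp [descending]
  have hne : ∀ {k : ℕ} {a b : ZMod n}, 0 < k → k < n → a - b = k → a ≠ b := by
    rintro k a _ h₀ h₁ h rfl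
    exact natCast_ne_zero h₀ h₁ (by rw [← h, sub_self])
  -- The strands in positions `p, ..., n - 1` have colours `j + 1, ..., i + 1`.
  have hw : ∀ k, leftWeight [up (j + 1), up j]
      (leftWeight (ups (descending (j - 1) (n - p - 2))) (ones n)) k =
      (1 : ℤ) + (Pi.single (i + 1) 1 : Weight n) k - (Pi.single (j + 1 + 1) 1 : Weight n) k := by
    intro k
    have h := leftWeight_descending (j + 1) (n - p - 2 + 1 + 1)
    have e : j + 1 - ((n - p - 2 + 1 + 1 : ℕ) : ZMod n) = i := by
      rw [show n - p - 2 + 1 + 1 = n - p by omega, Nat.cast_sub (by omega), ← hj]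
      simp
    rw [e] at h
    simp only [descending, add_sub_cancel_right] at h
    exact congrFun h k
  rw [hj, rightOf_comp_split _ _ _ (by simp)]
  rw [W_ccwBubble_ups (ones n) hK (length_descending _ _)]
  · exact (hne (k := 1) one_pos (by omega) (by push_cast; ring)).symm
  · exact (hne (k := 1) one_pos (by omega) (by push_cast; ring)).symm
  · intro l hl
    obtain ⟨r, hr, rfl⟩ := mem_descending hl
    refine ⟨(hne (k := r + 2) (by omega) (by omega) ?_).symm,
      (hne (k := r + 3) (by omega) (by omega) ?_).symm,
      hne (k := r + 1) (by omega) (by omega) ?_⟩ <;> push_cast <;> ring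
  · have a1 : j + 1 ≠ i + 1 :=
      (hne (k := p + 1) (by omega) (by omega)
        (by push_cast; rw [sub_eq_iff_eq_add.1 hj]; ring)).symm
    have a2 : j + 1 ≠ j + 1 + 1 :=
      (hne (k := 1) one_pos (by omega) (by push_cast; ring)).symm
    rw [hw, Pi.single_eq_of_ne a1, Pi.single_eq_of_ne a2]
    norm_num
  · have a1 : j + 1 + 1 ≠ i + 1 :=
      (hne (k := p) (by omega) (by omega) (by rw [sub_eq_iff_eq_add.1 hj]; ring)).symm
    rw [hw, Pi.single_eq_of_ne a1, Pi.single_eq_same]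
    norm_num

/-! ### The boxes next to a splitter -/

theorem val_sub_add_one (hn : 0 < n) (i : ZMod n) : (i - (i + 1)).val = n - 1 := by
  obtain ⟨m, rfl⟩ := Nat.exists_eq_succ_of_ne_zero hn.ne'
  rw [sub_add_cancel_left, ZMod.val_neg_one]
  rfl

theorem leftOf_neg (μ : Weight n) (f : End (ob ([] : Word n))) : leftOf μ (-f) = -leftOf μ f :=
  W_neg μ [] [dup] f rfl rfl

theorem leftOf_sum (μ : Weight n) {ι : Type*} (s : Finset ι) (f : ι → End (ob ([] : Word n))) :
    leftOf μ (∑ k ∈ s, f k) = ∑ k ∈ s, leftOf μ (f k) :=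
  W_sum μ [] [dup] s f rfl rfl

theorem rightOf_sum (μ : Weight n) {ι : Type*} (s : Finset ι) (f : ι → End (ob ([] : Word n))) :
    rightOf μ (∑ k ∈ s, f k) = ∑ k ∈ s, rightOf μ (f k) :=
  W_sum μ [dup] [] s f rfl rfl

theorem leftOf_zBox_split (hn : 3 ≤ n) (i : ZMod n) :
    leftOf (ones n) (zBox i (i + 1)) ≫ split (ones n) i =
      split (ones n) i ≫
        (dotAt (ones n) (colors i) (n - 1) - dotAt (ones n) (colors i) 0) := by
  have h : leftOf (ones n) (zBox i (i + 1)) =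
      -∑ k ∈ Finset.range (n - 1), rightOf (ones n) (ccwBubble (i - (k : ℕ)) 0) := by
    have e : ∀ k : ℕ, leftOf (ones n) (ccwBubble (i - 1 - k) 0) =
        rightOf (ones n) (ccwBubble (i - (k : ℕ)) 0) := by
      intro k
      rw [leftOf_ccwBubble_zero (by omega)]
      congr 2
      ring
    rw [zBox, leftOf_neg, leftOf_sum, val_sub_add_one (by omega)]
    exact congrArg Neg.neg (Finset.sum_congr rfl fun k _ => e k)
  rw [h, Preadditive.neg_comp, Preadditive.sum_comp,
    Finset.sum_congr rfl fun k hk => rightOf_ccwBubble_split hn i k (Finset.mem_range.1 hk),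
    ← Preadditive.comp_sum, Finset.sum_range_sub', ← Preadditive.comp_neg, neg_sub]

theorem rightOf_yBox_split (hn : 3 ≤ n) (i : ZMod n) :
    rightOf (ones n) (yBox i i) ≫ split (ones n) i =
      split (ones n) i ≫
        (dotAt (ones n) (colors i) 0 - dotAt (ones n) (colors i) (n - 1)) := by
  have h : rightOf (ones n) (yBox i i) =
      ∑ k ∈ Finset.range (n - 1), rightOf (ones n) (ccwBubble (i - (k : ℕ)) 0) := by
    -- The colours `i + 2 + k` of the box are the colours `i - k` in the opposite order.
    rw [yBox, rightOf_sum, val_sub_add_one (by omega), ← Finset.sum_range_reflect]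
    refine Finset.sum_congr rfl fun k hk => ?_
    refine (rightOf_congr (cwBubble_eq_ccwBubble _)).trans ?_
    have hk := Finset.mem_range.1 hk
    congr 2
    rw [show n - 1 - 1 - k = n - (k + 2) by omega, Nat.cast_sub (by omega)]
    push_cast
    simp
    ring
  rw [h, Preadditive.sum_comp,
    Finset.sum_congr rfl fun k hk => rightOf_ccwBubble_split hn i k (Finset.mem_range.1 hk),
    ← Preadditive.comp_sum, Finset.sum_range_sub']

/-- Closed diagrams commute (Eckmann--Hilton). -/
theorem twoMor_comm (μ : Weight n) (f g : End (ob ([] : Word n))) :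
    twoMor μ (f ≫ g : ob ([] : Word n) ⟶ ob []) = twoMor μ (g ≫ f : ob ([] : Word n) ⟶ ob []) := by
  have := twoMor_interchange μ (f : ob ([] : Word n) ⟶ ob []) (g : ob ([] : Word n) ⟶ ob [])
    [] [] [] (x := []) (y := []) (y' := []) (z := []) (c := []) (d := []) (c' := []) (d' := [])
    rfl rfl rfl rfl rfl rfl rfl rfl rfl rfl rfl rfl
  simpa only [wh_nil_nil] using this

theorem leftOf_comp (μ : Weight n) (f g : End (ob ([] : Word n))) :
    leftOf μ (f ≫ g : ob ([] : Word n) ⟶ ob []) = leftOf μ f ≫ leftOf μ g :=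
  W_comp μ [] [dup] f g rfl rfl rfl

theorem rightOf_comp (μ : Weight n) (f g : End (ob ([] : Word n))) :
    rightOf μ (f ≫ g : ob ([] : Word n) ⟶ ob []) = rightOf μ f ≫ rightOf μ g :=
  W_comp μ [dup] [] f g rfl rfl rfl

theorem twoMor_leftOfDelta (μ : Weight n) (f : End (ob ([] : Word n))) :
    twoMor μ (leftOfDelta f) = leftOf μ f :=
  congrArg (twoMor μ) (wh_rfl [] [dup] f).symm

theorem twoMor_rightOfDelta (μ : Weight n) (f : End (ob ([] : Word n))) :
    twoMor μ (rightOfDelta f) = rightOf μ f :=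
  congrArg (twoMor μ) (wh_rfl [dup] [] f).symm

end AffineSchur

end

theorem mainTheorem7 (n : ℕ) (hn : 3 ≤ n) (i : ZMod n) (s : ℕ) :
    (∑ j ∈ Finset.range (s + 1), (s.choose j : ℚ) •
        twoMor (ones n) (leftOfDelta (cwBubble i (s - j) ≫ zBox i (i + 1) ^ j)) =
      twoMor (ones n) (rightOfDelta (ccwBubble (i + 1) s))) ∧
    (∑ j ∈ Finset.range (s + 1), (s.choose j : ℚ) •
        twoMor (ones n) (rightOfDelta (ccwBubble (i + 1) (s - j) ≫ yBox i i ^ j)) =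
      twoMor (ones n) (leftOfDelta (cwBubble i s))) := by
  have hAB := dotAt_comm (by omega) i (ones n)
  constructor
  · have h := sum_choose_comp (split (ones n) i) (merge (ones n) i)
      (leftOf (ones n) (zBox i (i + 1))) (dotAt (ones n) (colors i) 0)
      (dotAt (ones n) (colors i) (n - 1) - dotAt (ones n) (colors i) 0)
      (leftOf_zBox_split hn i) (by rw [mul_sub, sub_mul, hAB]) s
    rw [add_sub_cancel] at h
    rw [twoMor_rightOfDelta, rightOf_ccwBubble (by omega)]
    refine Eq.trans (Finset.sum_congr rfl fun j _ => ?_) h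
    rw [twoMor_leftOfDelta, leftOf_congr (twoMor_comm _ _ _), leftOf_comp,
      leftOf_cwBubble (by omega)]
    exact congrArg (fun t => _ • (t ≫ _)) (WEnd_pow _ _ _ _ _ _)
  · have h := sum_choose_comp (split (ones n) i) (merge (ones n) i)
      (rightOf (ones n) (yBox i i)) (dotAt (ones n) (colors i) (n - 1))
      (dotAt (ones n) (colors i) 0 - dotAt (ones n) (colors i) (n - 1))
      (rightOf_yBox_split hn i) (by rw [mul_sub, sub_mul, hAB]) s
    rw [add_sub_cancel] at h
    rw [twoMor_leftOfDelta, leftOf_cwBubble (by omega)]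
    refine Eq.trans (Finset.sum_congr rfl fun j _ => ?_) h
    rw [twoMor_rightOfDelta, rightOf_congr (twoMor_comm _ _ _), rightOf_comp,
      rightOf_ccwBubble (by omega)]
    exact congrArg (fun t => _ • (t ≫ _)) (WEnd_pow _ _ _ _ _ _)
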